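/- Let $R$ be a commutative noetherian ring. For a module $M$ let $E(M)$ be its injective hull, and let $\mho^0M=M$, $\mho^{i+1}M=E(\mho^iM)/\mho^iM$ be the cosyzygies in its minimal injective coresolution. For $Y\subseteq\operatorname{Spec}R$ let $\mathcal I(Y)=\operatorname{Add}\big(\bigoplus_{\mathfrak p\in Y}E(R/\mathfrak p)\big)$ be the class of all direct summands of direct sums of copies of $\bigoplus_{\mathfrak p\in Y}E(R/\mathfrak p)$. An $\mathcal I(Y)$-precover of $M$ is a map $f\colon D\to M$ with $D\in\mathcal I(Y)$ through which every map $D'\to M$ with $D'\in\mathcal I(Y)$ factors; it is a cover if moreover every $g\in\operatorname{End}_R(D)$ with $fg=f$ is an automorphism. Let $Y_0\subseteq Y_1\subseteq\cdots$ be subsets of $\operatorname{Spec}R$, each closed under generalization (if $\mathfrak q\in Y_i$ and $\mathfrak p\subseteq\mathfrak q$ then $\mathfrak p\in Y_i$), such that $\operatorname{Ass}(\mho^iR)\subseteq Y_i$ for all $i\ge 0$, and assume $Y_n=\operatorname{Spec}R$ for some $n\ge1$. For each $\mathfrak p\in\operatorname{Spec}R$ let $k$ be least with $\mathfrak p\in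 Y_k$, put $K_k=E(R/\mathfrak p)$, for $j=k-1,\dots,0$ choose an $\mathcal I(Y_j)$-precover $\Phi_j\colon E_j\to K_{j+1}$ and put $K_j=\operatorname{Ker}\Phi_j$; let $C_{\mathfrak p}=K_0$ (so $C_{\mathfrak p}=E(R/\mathfrak p)$ for $\mathfrak p\in Y_0$). Put $C=\prod_{\mathfrak p\in\operatorname{Spec}R}C_{\mathfrak p}$. Then such choices exist, and the precovers can even be taken to be covers. For every such choice of precovers (in particular for covers): 1. ${}^\perp C=\operatorname{Cog}_nC$, where ${}^\perp C=\{M\mid \operatorname{Ext}^i_R(M,C)=0\text{ for all }i\ge1\}$, and $\operatorname{Cog}_nC$ is the class of modules $M$ having an exact sequence $0\to M\to C_0\to C_1\to\cdots$ in which $C_i$ is a product of copies of $C$ for each $i<n$. 2. $C$ is an $n$-cotilting module, that is: $C$ has injective dimension at most $n$; $\operatorname{Ext}^i_R(C^\kappa,C)=0$ for all $i\ge1$ and all cardinals $\kappa$; and for some $r\ge 0$ there is an exact sequence $0\to C_r\to\cdots\to C_0\to W\to0$ where $W$ is an injective cogenerator and every $C_i$ is a direct summand of a direct product of copies of $C$.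 3. $C$ induces the class $\mathcal C(Y_0,\dots,Y_{n-1})$, that is, ${}^\perp C$ is the class of all modules $X$ such that for every $i\ge0$ the $i$-th term $E(\mho^iX)$ of the minimal injective coresolution of $X$ is of the form $\bigoplus_{\mathfrak p\in Y_i}E(R/\mathfrak p)^{(I_{\mathfrak p,i})}$ for some sets $I_{\mathfrak p,i}$. -/

import Mathlib

namespace CotiltConstr

open CategoryTheory
open scoped DirectSum

universe u

section Hull

variable {R : Type u} [CommRing R]

/-- `ι : M → E` is an injective hull: `E` is injective, `ι` is a monomorphism and its image is an
essential submodule of `E`. -/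
structure IsInjectiveHull {M E : ModuleCat.{u} R} (ι : M →ₗ[R] E) : Prop where
  injective_module : Module.Injective R E
  mono : Function.Injective ι
  essential : ∀ L : Submodule R E, Disjoint L (LinearMap.range ι) → L = ⊥

theorem exists_isInjectiveHull (M : ModuleCat.{u} R) :
    ∃ (E : ModuleCat.{u} R) (ι : M →ₗ[R] E), IsInjectiveHull ι := by
  obtain ⟨Q, hQ, j, hj⟩ : ∃ (Q : ModuleCat.{u} R) (_ : Module.Injective R Q) (j : M →ₗ[R] Q),
      Function.Injective j :=
    ⟨Injective.under M,
      (Module.injective_iff_injective_object R _).2 (Injective.injective_under M),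
      (Injective.ι M).hom,
      (ModuleCat.mono_iff_injective _).1 inferInstance⟩
  obtain ⟨N, hAN, hN⟩ := zorn_le_nonempty₀
    {N : Submodule R Q | LinearMap.range j ≤ N ∧
      ∀ L ≤ N, Disjoint L (LinearMap.range j) → L = ⊥}
    (by
      intro c hc hchain N₀ hN₀
      refine ⟨sSup c, ⟨(hc hN₀).1.trans (le_sSup hN₀), fun L hL hd => ?_⟩,
        fun z hz => le_sSup hz⟩
      rw [Submodule.eq_bot_iff]
      intro x hx
      obtain ⟨N', hN', hxN'⟩ :=
        (Submodule.mem_sSup_of_directed ⟨N₀, hN₀⟩ hchain.directedOn).1 (hL hx)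
      have hspan : Submodule.span R {x} = ⊥ :=
        (hc hN').2 _ ((Submodule.span_singleton_le_iff_mem _ _).2 hxN')
          (hd.mono_left ((Submodule.span_singleton_le_iff_mem _ _).2 hx))
      simpa using hspan)
    (LinearMap.range j) ⟨le_rfl, fun L hL hd => by
      rw [← hd.eq_bot, inf_eq_left.2 hL]⟩
  obtain ⟨K, -, hK⟩ := zorn_le_nonempty₀ {K : Submodule R Q | Disjoint K N}
    (by
      intro c hc hchain K₀ hK₀
      refine ⟨sSup c, ?_, fun z hz => le_sSup hz⟩
      refine Submodule.disjoint_def.2 ?_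
      intro x hx hxN
      obtain ⟨K', hK', hxK'⟩ :=
        (Submodule.mem_sSup_of_directed ⟨K₀, hK₀⟩ hchain.directedOn).1 hx
      exact Submodule.disjoint_def.1 (hc hK') x hxK' hxN)
    ⊥ disjoint_bot_left
  have hπ : Function.Injective (K.mkQ ∘ₗ N.subtype) := by
    rw [← LinearMap.ker_eq_bot, Submodule.eq_bot_iff]
    intro x hx
    have hxK : (x : Q) ∈ K := by simpa using hx
    exact Subtype.ext (Submodule.disjoint_def.1 hK.prop x hxK x.2)
  obtain ⟨g, hg⟩ := Module.Baer.extension_property (Module.Baer.of_injective hQ)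
    (K.mkQ ∘ₗ N.subtype) hπ N.subtype
  have hgN : ∀ x ∈ N, g (K.mkQ x) = x := fun x hx => LinearMap.congr_fun hg ⟨x, hx⟩
  have hrange : LinearMap.range g ≤ N := by
    refine hN.2 ⟨hAN.trans fun x hx => ⟨K.mkQ x, hgN x hx⟩, fun L hL hd => ?_⟩
      fun x hx => ⟨K.mkQ x, hgN x hx⟩
    have hLN : L ⊓ N = ⊥ := hN.prop.2 _ inf_le_right (hd.mono_left inf_le_left)
    have hle : L.comap (g ∘ₗ K.mkQ) ≤ K := by
      refine hK.2 ?_ fun x hx => ?_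
      · refine Submodule.disjoint_def.2 ?_
        intro x hx hxN
        have hxL : g (K.mkQ x) ∈ L := hx
        rw [hgN x hxN] at hxL
        have : x ∈ L ⊓ N := ⟨hxL, hxN⟩
        simpa [hLN] using this
      · have : K.mkQ x = 0 := by simpa using hx
        simp [Submodule.mem_comap, this]
    rw [Submodule.eq_bot_iff]
    intro y hy
    obtain ⟨z, rfl⟩ := hL hy
    obtain ⟨x, rfl⟩ := K.mkQ_surjective z
    have hxK : x ∈ K := hle hy
    have : K.mkQ x = 0 := by simpa using hxK
    rw [this, map_zero]
  refine ⟨ModuleCat.of R N, j.codRestrict N fun x => hAN ⟨x, rfl⟩, ?_, ?_, ?_⟩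
  · refine ⟨fun X Y _ _ _ _ f hf h => ?_⟩
    obtain ⟨h', hh'⟩ := hQ.out f hf (N.subtype ∘ₗ h)
    refine ⟨(g ∘ₗ K.mkQ ∘ₗ h').codRestrict N fun x => hrange ⟨_, rfl⟩, fun x => ?_⟩
    refine Subtype.ext ?_
    change g (K.mkQ (h' (f x))) = _
    rw [hh']
    exact hgN _ (h x).2
  · intro x y hxy
    exact hj (congrArg Subtype.val hxy)
  · intro L hL
    have h1 : L.map N.subtype = ⊥ := by
      refine hN.prop.2 _ (Submodule.map_subtype_le _ _) ?_
      rw [Submodule.disjoint_def]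
      rintro _ ⟨x, hx, rfl⟩ ⟨m, hm⟩
      have : x = 0 := Submodule.disjoint_def.1 hL x hx ⟨m, Subtype.ext hm⟩
      simp [this]
    rw [Submodule.eq_bot_iff]
    intro x hx
    have h2 : (x : Q) ∈ L.map N.subtype := ⟨x, hx, rfl⟩
    rw [h1, Submodule.mem_bot] at h2
    exact Subtype.ext h2

/-- The injective hull `E(M)`. -/
noncomputable def injectiveHull (M : ModuleCat.{u} R) : ModuleCat.{u} R :=
  (exists_isInjectiveHull M).choose

/-- The embedding `M → E(M)`. -/
noncomputable def hullMap (M : ModuleCat.{u} R) : M →ₗ[R] injectiveHull M :=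
  (exists_isInjectiveHull M).choose_spec.choose

theorem isInjectiveHull_hullMap (M : ModuleCat.{u} R) : IsInjectiveHull (hullMap M) :=
  (exists_isInjectiveHull M).choose_spec.choose_spec

/-- The `i`-th cosyzygy `℧ⁱ M` in the minimal injective coresolution
`0 → M → E(M) → E(℧¹ M) → E(℧² M) → ⋯`: `℧⁰ M = M` and `℧ⁱ⁺¹ M = E(℧ⁱ M) / ℧ⁱ M`. -/
noncomputable def cosyzygy (M : ModuleCat.{u} R) : ℕ → ModuleCat.{u} R
  | 0 => M
  | i + 1 => ModuleCat.of R (injectiveHull (cosyzygy M i) ⧸ LinearMap.range (hullMap (cosyzygy M i)))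

/-- `E(R/𝔭)`. -/
noncomputable def primeHull (p : PrimeSpectrum R) : ModuleCat.{u} R :=
  injectiveHull (ModuleCat.of R (R ⧸ p.asIdeal))

end Hull

section Classes

variable {R : Type u} [CommRing R]

/-- `N` is (isomorphic to) a direct summand of `M`. -/
def IsSummand (N M : ModuleCat.{u} R) : Prop :=
  ∃ (s : N →ₗ[R] M) (r : M →ₗ[R] N), r ∘ₗ s = LinearMap.id

/-- `Add M`: direct summands of direct sums of copies of `M`. -/
def addClass (M : ModuleCat.{u} R) : ObjectProperty (ModuleCat.{u} R) := fun N =>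
  ∃ I : Type u, IsSummand N (ModuleCat.of R (I →₀ M))

/-- `Prod M`: direct summands of direct products of copies of `M`. -/
def prodClass (M : ModuleCat.{u} R) : ObjectProperty (ModuleCat.{u} R) := fun N =>
  ∃ I : Type u, IsSummand N (ModuleCat.of R (I → M))

/-- `I(Y) = Add (⨁_{𝔭 ∈ Y} E(R/𝔭))`. -/
def injClass (Y : Set (PrimeSpectrum R)) : ObjectProperty (ModuleCat.{u} R) :=
  addClass (ModuleCat.of R (⨁ p : Y, primeHull p.1))

/-- `f : D → M` is a `P`-precover of `M`. -/
def IsPrecover (P : ObjectProperty (ModuleCat.{u} R)) {D M : ModuleCat.{u} R}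
    (f : D →ₗ[R] M) : Prop :=
  P D ∧ ∀ D' : ModuleCat.{u} R, P D' → ∀ f' : D' →ₗ[R] M, ∃ g : D' →ₗ[R] D, f' = f ∘ₗ g

/-- `f : D → M` is a `P`-cover of `M`. -/
def IsCover (P : ObjectProperty (ModuleCat.{u} R)) {D M : ModuleCat.{u} R}
    (f : D →ₗ[R] M) : Prop :=
  IsPrecover P f ∧ ∀ g : D →ₗ[R] D, f = f ∘ₗ g → Function.Bijective g

/-- `⊥C`: the modules `M` with `Extⁱ(M, C) = 0` for all `i ≥ 1`. -/
def leftPerp (C : ModuleCat.{u} R) : ObjectProperty (ModuleCat.{u} R) := fun M =>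
  ∀ i : ℕ, 1 ≤ i → Subsingleton (Abelian.Ext.{u} M C i)

/-- `Cog_n C`: the modules `M` that fit into a long exact sequence
`0 → M → C₀ → C₁ → ⋯` where `C_i` is a product of copies of `C` for each `i < n`. -/
def cogClass (n : ℕ) (C : ModuleCat.{u} R) : ObjectProperty (ModuleCat.{u} R) := fun M =>
  ∃ (D : ℕ → ModuleCat.{u} R) (ι : M →ₗ[R] D 0) (d : ∀ i, D i →ₗ[R] D (i + 1)),
    Function.Injective ι ∧ Function.Exact ι (d 0) ∧ (∀ i, Function.Exact (d i) (d (i + 1))) ∧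
    ∀ i < n, ∃ I : Type u, Nonempty (D i ≃ₗ[R] (I → C))

/-- Cotilting modules. In the third condition the exact sequence
`0 → C_r → ⋯ → C₀ → W → 0` is extended by zeros to the left. -/
structure IsCotilting (C : ModuleCat.{u} R) : Prop where
  finite_injDim : ∃ m : ℕ, HasInjectiveDimensionLE C m
  ext_pow : ∀ (κ : Type u) (i : ℕ), 1 ≤ i →
    Subsingleton (Abelian.Ext.{u} (ModuleCat.of R (κ → C)) C i)
  resolution : ∃ (W : ModuleCat.{u} R) (r : ℕ) (D : ℕ → ModuleCat.{u} R)
    (ε : D 0 →ₗ[R] W) (d : ∀ i, D (i + 1) →ₗ[R] D i),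
    Injective W ∧ IsCoseparator W ∧
    Function.Surjective ε ∧ Function.Exact (d 0) ε ∧ (∀ i, Function.Exact (d (i + 1)) (d i)) ∧
    (∀ i ≤ r, prodClass C (D i)) ∧ ∀ i, r < i → Subsingleton (D i)

/-- `n`-cotilting modules: cotilting modules of injective dimension at most `n`. -/
def IsNCotilting (n : ℕ) (C : ModuleCat.{u} R) : Prop :=
  IsCotilting C ∧ HasInjectiveDimensionLE C n

/-- `C(Y₀, Y₁, …)`: the modules `X` whose minimal injective coresolution has `i`-th term
`E(℧ⁱ X)` of the form `⨁_{𝔭 ∈ Y_i} E(R/𝔭)^(I_𝔭)` for each `i`. If `Y_i = Spec R` for all `i ≥ n`,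
this class is also written `C(Y₀, …, Y_{n-1})`. -/
def cotiltClass (Y : ℕ → Set (PrimeSpectrum R)) : ObjectProperty (ModuleCat.{u} R) := fun X =>
  ∀ i : ℕ, ∃ I : Y i → Type u,
    Nonempty (injectiveHull (cosyzygy X i) ≃ₗ[R] ⨁ p : Y i, (I p →₀ primeHull p.1))

end Classes

section Construction

variable {R : Type u} [CommRing R]

/-- The iterated precover construction for a prime `𝔭`. Let `k` be least with `𝔭 ∈ Y_k`. Starting
from `K_k = E(R/𝔭)`, for `j = k - 1, …, 0` one takes an `I(Y_j)`-precover `Φ_j : E_j → K_{j+1}`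
and its kernel `ν_j : K_j → E_j`. With `φ_j = ν_{j+1} Φ_j` these form the complex
`0 → K_0 → E_0 → ⋯ → E_{k-1} → E(R/𝔭) → 0`, and `C_𝔭 = K_0`; for `k = 0` this is
`C_𝔭 = E(R/𝔭)`. The entries with `j ≥ k` (`j > k` for `K`) play no role. -/
structure PrecoverComplex (Y : ℕ → Set (PrimeSpectrum R)) (p : PrimeSpectrum R) where
  k : ℕ
  isLeast_k : IsLeast {j | p ∈ Y j} k
  K : ℕ → ModuleCat.{u} R
  E : ℕ → ModuleCat.{u} R
  ν : ∀ j, K j →ₗ[R] E j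
  Φ : ∀ j, E j →ₗ[R] K (j + 1)
  top : K k ≃ₗ[R] primeHull p
  isPrecover : ∀ j < k, IsPrecover (injClass (Y j)) (Φ j)
  ν_injective : ∀ j < k, Function.Injective (ν j)
  ν_exact : ∀ j < k, Function.Exact (ν j) (Φ j)

namespace PrecoverComplex

variable {Y : ℕ → Set (PrimeSpectrum R)} {p : PrimeSpectrum R}

/-- All the precovers of the construction are covers. -/
def ByCovers (D : PrecoverComplex Y p) : Prop :=
  ∀ j < D.k, IsCover (injClass (Y j)) (D.Φ j)

/-- The module `C_𝔭` produced by the construction. -/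
def component (D : PrecoverComplex Y p) : ModuleCat.{u} R := D.K 0

end PrecoverComplex

/-- `C = ∏_𝔭 C_𝔭`. -/
def cotiltModule {Y : ℕ → Set (PrimeSpectrum R)} (D : ∀ p, PrecoverComplex Y p) :
    ModuleCat.{u} R :=
  ModuleCat.of R (∀ p, (D p).component)

end Construction

end CotiltConstr

/-! Everything is compared with `extClass Y`, the class of X with Extⁱ(R/𝔭, X) = 0 whenever 𝔭 ∉ Y_i.
Shifting along the minimal injective coresolution turns this into Hom(R/𝔭, ℧ⁱX) = 0, and Matlis'
decomposition of injectives identifies the class with `cotiltClass Y` (`extClass_eq_cotiltClass`).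
The hypothesis on Ass(℧ⁱR) puts R into it.

The engine is a lifting argument (`PrecoverComplex.exists_lift`). Let Extʲ(R/𝔮, X) = 0 whenever 𝔮 ∉
Y_{i+j}. Then E(X) lies in I(Y_i), and E(X)/X satisfies the same condition for i + 1. If
Ext¹(E(X)/X, K_{i+1}) = 0, every map X → K_{i+1} extends to E(X) and hence factors through the
precover Φ_i. For X = R this makes Φ_i surjective; for general X it carries Ext-vanishing from
K_{i+1} down to K_i. Hence `extClass Y` ⊆ ⊥C. The C_𝔭 are iterated kernels, so C and its powers lie
in `extClass Y`, and Extⁱ(C^κ, C) = 0 for i ≥ 1.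

Since the Φ_j are onto, 0 → C_𝔭 → E_0 → ⋯ → E(R/𝔭) → 0 is exact of length k ≤ n with E_j in I(Y_j).
This bounds the injective dimension. Read from the left, it gives by induction on j finite Prod
C-resolutions, of uniformly bounded length, for the modules in I(Y_j), among them W = ∏ E(R/𝔭)
(`exists_prodRes_of_injClass`). If X ∈ ⊥C, maps X → W lift to Prod C, so X embeds in a power of C
with cokernel again in ⊥C; thus ⊥C ⊆ Cog_n C. Dimension shifting gives Cog_n C ⊆ `extClass Y`, which
closes the circle. -/

namespace CotiltConstr

open CategoryTheory
open scoped DirectSum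

universe u

/-! ### Vanishing of Ext along short exact sequences -/

section ExtVanishing

variable {R : Type u} [CommRing R]

/-- `0 → A → B → C → 0` is a short exact sequence. -/
structure IsShortExact {A B C : ModuleCat.{u} R} (f : A →ₗ[R] B) (g : B →ₗ[R] C) : Prop where
  injective : Function.Injective f
  exact : Function.Exact f g
  surjective : Function.Surjective g

theorem isShortExact_ker {B C : ModuleCat.{u} R} {g : B →ₗ[R] C} (hg : Function.Surjective g) :
    IsShortExact (A := ModuleCat.of R (LinearMap.ker g)) (LinearMap.ker g).subtype g :=
  ⟨Subtype.val_injective, LinearMap.exact_subtype_ker_map g, hg⟩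

theorem isShortExact_coker {A B : ModuleCat.{u} R} {f : A →ₗ[R] B} (hf : Function.Injective f) :
    IsShortExact (C := ModuleCat.of R (B ⧸ LinearMap.range f)) f (LinearMap.range f).mkQ :=
  ⟨hf, LinearMap.exact_map_mkQ_range f, Submodule.mkQ_surjective _⟩

/-- `Extⁱ(X, A) = 0`. -/
abbrev ExtZero (X A : ModuleCat.{u} R) (i : ℕ) : Prop := Subsingleton (Abelian.Ext.{u} X A i)

theorem extZero_iff {X A : ModuleCat.{u} R} {i : ℕ} :
    ExtZero X A i ↔ ∀ e : Abelian.Ext.{u} X A i, e = 0 :=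
  ⟨fun _ _ => Subsingleton.elim _ _, fun h => subsingleton_of_forall_eq 0 h⟩

theorem extZero_zero_iff {X A : ModuleCat.{u} R} :
    ExtZero X A 0 ↔ ∀ f : X →ₗ[R] A, f = 0 := by
  rw [ExtZero, Abelian.Ext.homEquiv₀.subsingleton_congr]
  constructor
  · intro h f
    have := congrArg ModuleCat.Hom.hom (Subsingleton.elim (ModuleCat.ofHom f) 0)
    simpa using this
  · intro h
    refine subsingleton_of_forall_eq 0 fun f => ?_
    ext1
    exact h f.hom

theorem extZero_of_injective (X : ModuleCat.{u} R) {A : ModuleCat.{u} R}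
    (hA : Module.Injective R A) (i : ℕ) : ExtZero X A (i + 1) := by
  have : Injective A := (Module.injective_iff_injective_object R A).1 hA
  exact Abelian.Ext.subsingleton_of_injective X A i

theorem ExtZero.of_isSummand {X A B : ModuleCat.{u} R} {i : ℕ} (h : ExtZero X B i)
    (hAB : IsSummand A B) : ExtZero X A i := by
  obtain ⟨s, r, hrs⟩ := hAB
  refine extZero_iff.2 fun e => ?_
  have h1 : ModuleCat.ofHom s ≫ ModuleCat.ofHom r = 𝟙 A := by
    rw [← ModuleCat.ofHom_comp, hrs]; rfl
  have h2 : e.comp (Abelian.Ext.mk₀ (ModuleCat.ofHom s)) (add_zero i) = 0 := extZero_iff.1 h _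
  rw [← e.comp_mk₀_id, ← h1, ← Abelian.Ext.mk₀_comp_mk₀,
    ← Abelian.Ext.comp_assoc_of_third_deg_zero, h2, Abelian.Ext.zero_comp]

namespace IsShortExact

variable {A B C : ModuleCat.{u} R} {f : A →ₗ[R] B} {g : B →ₗ[R] C}

/-- The short complex in `ModuleCat R` underlying a short exact sequence. -/
abbrev shortComplex (h : IsShortExact f g) : ShortComplex (ModuleCat.{u} R) :=
  ShortComplex.mk (ModuleCat.ofHom f) (ModuleCat.ofHom g) (by
    rw [← ModuleCat.ofHom_comp, h.exact.linearMap_comp_eq_zero]; rfl)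

theorem shortExact (h : IsShortExact f g) : h.shortComplex.ShortExact :=
  ModuleCat.shortComplex_shortExact _ h.exact h.injective h.surjective

variable (h : IsShortExact f g) {X : ModuleCat.{u} R} {i : ℕ}

include h

theorem extZero_left (hC : ExtZero X C i) (hB : ExtZero X B (i + 1)) : ExtZero X A (i + 1) := by
  refine extZero_iff.2 fun e => ?_
  obtain ⟨y, rfl⟩ := Abelian.Ext.covariant_sequence_exact₁ X h.shortExact e
    (extZero_iff.1 hB _) rfl
  rw [extZero_iff.1 hC y, Abelian.Ext.zero_comp]

theorem extZero_right (hB : ExtZero X B i) (hA : ExtZero X A (i + 1)) : ExtZero X C i := by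
  refine extZero_iff.2 fun e => ?_
  obtain ⟨y, rfl⟩ := Abelian.Ext.covariant_sequence_exact₃ X h.shortExact e rfl
    (extZero_iff.1 hA _)
  rw [extZero_iff.1 hB y, Abelian.Ext.zero_comp]

theorem extZero_one_left (hB : ExtZero X B 1)
    (hsurj : ∀ φ : X →ₗ[R] C, ∃ ψ : X →ₗ[R] B, g ∘ₗ ψ = φ) :
    ExtZero X A 1 := by
  refine extZero_iff.2 fun e => ?_
  obtain ⟨y, rfl⟩ := Abelian.Ext.covariant_sequence_exact₁ X h.shortExact e
    (extZero_iff.1 hB _) (zero_add 1)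
  obtain ⟨φ, rfl⟩ := Abelian.Ext.homEquiv₀.symm.surjective y
  obtain ⟨ψ, hψ⟩ := hsurj φ.hom
  have : φ = ModuleCat.ofHom ψ ≫ h.shortComplex.g := by
    ext1; exact hψ.symm
  rw [Abelian.Ext.homEquiv₀_symm_apply, this, ← Abelian.Ext.mk₀_comp_mk₀,
    Abelian.Ext.comp_assoc_of_second_deg_zero, h.shortExact.comp_extClass, Abelian.Ext.comp_zero]

theorem exists_lift (hA : ExtZero X A 1) (φ : X →ₗ[R] C) : ∃ ψ : X →ₗ[R] B, g ∘ₗ ψ = φ := by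
  obtain ⟨y, hy⟩ := Abelian.Ext.covariant_sequence_exact₃ X h.shortExact
    (Abelian.Ext.mk₀ (ModuleCat.ofHom φ)) (zero_add 1) (extZero_iff.1 hA _)
  obtain ⟨ψ, rfl⟩ := Abelian.Ext.homEquiv₀.symm.surjective y
  refine ⟨ψ.hom, ?_⟩
  rw [Abelian.Ext.homEquiv₀_symm_apply, Abelian.Ext.mk₀_comp_mk₀] at hy
  have := Abelian.Ext.homEquiv₀.symm.injective hy
  exact congrArg ModuleCat.Hom.hom this

theorem extZero_right' (hA : ExtZero A X i) (hB : ExtZero B X (i + 1)) : ExtZero C X (i + 1) := by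
  refine extZero_iff.2 fun e => ?_
  obtain ⟨y, rfl⟩ := Abelian.Ext.contravariant_sequence_exact₃ h.shortExact X e
    (extZero_iff.1 hB _) (add_comm 1 i)
  rw [extZero_iff.1 hA y, Abelian.Ext.comp_zero]

theorem extZero_left' (hB : ExtZero B X i) (hC : ExtZero C X (i + 1)) : ExtZero A X i := by
  refine extZero_iff.2 fun e => ?_
  obtain ⟨y, rfl⟩ := Abelian.Ext.contravariant_sequence_exact₁ h.shortExact X e (add_comm 1 i)
    (extZero_iff.1 hC _)
  rw [extZero_iff.1 hB y, Abelian.Ext.comp_zero]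

theorem extZero_one_right' (hB : ExtZero B X 1)
    (hsurj : ∀ φ : A →ₗ[R] X, ∃ ψ : B →ₗ[R] X, ψ ∘ₗ f = φ) : ExtZero C X 1 := by
  refine extZero_iff.2 fun e => ?_
  obtain ⟨y, rfl⟩ := Abelian.Ext.contravariant_sequence_exact₃ h.shortExact X e
    (extZero_iff.1 hB _) (add_zero 1)
  obtain ⟨φ, rfl⟩ := Abelian.Ext.homEquiv₀.symm.surjective y
  obtain ⟨ψ, hψ⟩ := hsurj φ.hom
  have : φ = h.shortComplex.f ≫ ModuleCat.ofHom ψ := by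
    ext1; exact hψ.symm
  rw [Abelian.Ext.homEquiv₀_symm_apply, this, ← Abelian.Ext.mk₀_comp_mk₀,
    h.shortExact.extClass_comp_assoc]

theorem exists_extend (hC : ExtZero C X 1) (φ : A →ₗ[R] X) : ∃ ψ : B →ₗ[R] X, ψ ∘ₗ f = φ := by
  obtain ⟨y, hy⟩ := Abelian.Ext.contravariant_sequence_exact₁ h.shortExact X
    (Abelian.Ext.mk₀ (ModuleCat.ofHom φ)) (add_zero 1) (extZero_iff.1 hC _)
  obtain ⟨ψ, rfl⟩ := Abelian.Ext.homEquiv₀.symm.surjective y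
  refine ⟨ψ.hom, ?_⟩
  rw [Abelian.Ext.homEquiv₀_symm_apply, Abelian.Ext.mk₀_comp_mk₀] at hy
  have := Abelian.Ext.homEquiv₀.symm.injective hy
  exact congrArg ModuleCat.Hom.hom this

end IsShortExact

theorem exists_projective_presentation (X : ModuleCat.{u} R) :
    ∃ (N P : ModuleCat.{u} R) (f : N →ₗ[R] P) (g : P →ₗ[R] X), IsShortExact f g ∧
      ∀ (A : ModuleCat.{u} R) (i : ℕ), ExtZero P A (i + 1) := by
  let g : ModuleCat.of R (X →₀ R) →ₗ[R] X := Finsupp.linearCombination R id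
  have hg : Function.Surjective g := fun x => ⟨Finsupp.single x 1, by simp [g]⟩
  refine ⟨_, _, _, g, isShortExact_ker hg, fun A i => ?_⟩
  have : Projective (ModuleCat.of R (X →₀ R)) :=
    (IsProjective.iff_projective _).1 inferInstance
  exact Abelian.Ext.subsingleton_of_projective _ _ _

/-- Dimension shifting in X along a projective presentation reduces to Ext¹, where maps into the
product are extended componentwise. -/
theorem extZero_pi {ι : Type u} {A : ι → ModuleCat.{u} R} {X : ModuleCat.{u} R} {i : ℕ}
    (h : ∀ j, ExtZero X (A j) i) : ExtZero X (ModuleCat.of R (∀ j, A j)) i := by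
  induction i generalizing X with
  | zero =>
    refine extZero_zero_iff.2 fun f => ?_
    ext x j
    exact LinearMap.congr_fun (extZero_zero_iff.1 (h j) (LinearMap.proj j ∘ₗ f)) x
  | succ i ih =>
    obtain ⟨N, P, f, g, hfg, hP⟩ := exists_projective_presentation X
    cases i with
    | zero =>
      refine hfg.extZero_one_right' (hP _ _) fun φ => ?_
      choose ψ hψ using fun j => hfg.exists_extend (h j) (LinearMap.proj j ∘ₗ φ)
      refine ⟨LinearMap.pi ψ, ?_⟩
      ext x j
      exact LinearMap.congr_fun (hψ j) x
    | succ i =>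
      exact hfg.extZero_right' (ih fun j => hfg.extZero_left' (hP _ _) (h j)) (hP _ _)

end ExtVanishing

/-! ### Injective modules over a noetherian ring -/

section Injectives

variable {R : Type u} [CommRing R]

theorem injective_of_isSummand {N M : ModuleCat.{u} R} (h : IsSummand N M)
    (hM : Module.Injective R M) : Module.Injective R N := by
  obtain ⟨s, r, hrs⟩ := h
  refine ⟨fun X Y _ _ _ _ f hf φ => ?_⟩
  obtain ⟨ψ, hψ⟩ := hM.out f hf (s ∘ₗ φ)
  refine ⟨r ∘ₗ ψ, fun x => ?_⟩
  have := LinearMap.congr_fun hrs (φ x)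
  simpa [hψ] using this

theorem isSummand_of_equiv {N M : ModuleCat.{u} R} (e : N ≃ₗ[R] M) : IsSummand N M :=
  ⟨e, e.symm, by ext; simp⟩

theorem IsSummand.trans {N M L : ModuleCat.{u} R} (h₁ : IsSummand N M) (h₂ : IsSummand M L) :
    IsSummand N L := by
  obtain ⟨s, r, h⟩ := h₁
  obtain ⟨s', r', h'⟩ := h₂
  refine ⟨s' ∘ₗ s, r ∘ₗ r', ?_⟩
  rw [LinearMap.comp_assoc, ← LinearMap.comp_assoc s, h', LinearMap.id_comp, h]

theorem isSummand_of_injective {N M : ModuleCat.{u} R} (hN : Module.Injective R N)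
    {s : N →ₗ[R] M} (hs : Function.Injective s) : IsSummand N M := by
  obtain ⟨r, hr⟩ := hN.out s hs LinearMap.id
  exact ⟨s, r, LinearMap.ext hr⟩

theorem isSummand_pi {ι : Type u} {N M : ι → ModuleCat.{u} R} (h : ∀ i, IsSummand (N i) (M i)) :
    IsSummand (ModuleCat.of R (∀ i, N i)) (ModuleCat.of R (∀ i, M i)) := by
  choose s r h using h
  refine ⟨LinearMap.pi fun i => s i ∘ₗ LinearMap.proj i,
    LinearMap.pi fun i => r i ∘ₗ LinearMap.proj i, ?_⟩
  ext x i
  exact LinearMap.congr_fun (h i) (x i)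

theorem injective_prod {N M : ModuleCat.{u} R} (hN : Module.Injective R N)
    (hM : Module.Injective R M) : Module.Injective R (N × M) := by
  refine ⟨fun X Y _ _ _ _ f hf φ => ?_⟩
  obtain ⟨g, hg⟩ := hN.out f hf (LinearMap.fst R N M ∘ₗ φ)
  obtain ⟨h, hh⟩ := hM.out f hf (LinearMap.snd R N M ∘ₗ φ)
  exact ⟨g.prod h, fun x => Prod.ext (hg x) (hh x)⟩

/-- An injective submodule has a complement. -/
theorem exists_isCompl_of_injective {E : ModuleCat.{u} R} (N : Submodule R E)
    (hN : Module.Injective R N) : ∃ N' : Submodule R E, IsCompl N N' := by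
  obtain ⟨r, hr⟩ := hN.out N.subtype N.injective_subtype LinearMap.id
  exact ⟨_, LinearMap.isCompl_of_proj (f := r) hr⟩

theorem isSummand_of_isCompl {E : ModuleCat.{u} R} {N N' : Submodule R E} (h : IsCompl N N') :
    IsSummand (ModuleCat.of R N) E :=
  ⟨N.subtype, N.projectionOnto N' h, by ext x; simp⟩

/-- A linear map that is injective on an essential submodule is injective. -/
theorem IsInjectiveHull.injective_of_comp {M E : ModuleCat.{u} R} {ι : M →ₗ[R] E}
    (h : IsInjectiveHull ι) {N : ModuleCat.{u} R} {φ : E →ₗ[R] N}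
    (hφ : Function.Injective (φ ∘ₗ ι)) : Function.Injective φ := by
  rw [← LinearMap.ker_eq_bot]
  refine h.essential _ (Submodule.disjoint_def.2 ?_)
  rintro _ hx ⟨m, rfl⟩
  have : m = 0 := hφ (by simpa using hx)
  simp [this]

theorem IsInjectiveHull.exists_smul {M E : ModuleCat.{u} R} {ι : M →ₗ[R] E}
    (h : IsInjectiveHull ι) {x : E} (hx : x ≠ 0) : ∃ (a : R) (m : M), m ≠ 0 ∧ ι m = a • x := by
  by_contra! hne
  refine hx ?_
  have := h.essential (Submodule.span R {x}) (Submodule.disjoint_def.2 ?_)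
  · simpa using this
  · rintro y hy ⟨m, rfl⟩
    obtain ⟨a, ha⟩ := Submodule.mem_span_singleton.1 hy
    by_cases hm : m = 0
    · simp [hm]
    · exact absurd ha.symm (hne a m hm)

variable [IsNoetherianRing R]

/-- Over a noetherian ring, a directed union of injective submodules is injective. -/
theorem injective_sSup {E : ModuleCat.{u} R} {c : Set (Submodule R E)} (hne : c.Nonempty)
    (hdir : DirectedOn (· ≤ ·) c) (hc : ∀ N ∈ c, Module.Injective R N) :
    Module.Injective R (sSup c : Submodule R E) := by
  refine Module.Baer.injective fun I φ => ?_
  -- I is finitely generated, so the image of φ already lies in one member of the directed family.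
  obtain ⟨N, hN, hle⟩ : ∃ N ∈ c, ∀ x, ((φ x : (sSup c : Submodule R E)) : E) ∈ N := by
    have hfg : (LinearMap.range ((sSup c).subtype ∘ₗ φ)).FG :=
      Module.Finite.iff_fg.1 inferInstance
    obtain ⟨N, hN, hle⟩ := (CompleteLattice.isCompactElement_iff_le_of_directed_sSup_le _ _).1
      ((Submodule.fg_iff_compact _).1 hfg) c hne hdir (by
        rintro _ ⟨x, rfl⟩
        exact (φ x).2)
    exact ⟨N, hN, fun x => hle ⟨x, rfl⟩⟩
  obtain ⟨ψ, hψ⟩ := Module.Baer.of_injective (hc N hN) I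
    (((sSup c).subtype ∘ₗ φ).codRestrict N hle)
  refine ⟨Submodule.inclusion (le_sSup hN) ∘ₗ ψ, fun x hx => ?_⟩
  have h : (ψ x : E) = φ ⟨x, hx⟩ := congrArg (Subtype.val : N → E) (hψ x hx)
  exact Subtype.ext h

/-- Over a noetherian ring, direct sums of injective modules are injective. -/
theorem injective_directSum {ι : Type u} {E : ι → ModuleCat.{u} R}
    (hE : ∀ i, Module.Injective R (E i)) : Module.Injective R (⨁ i, E i) := by
  classical
  refine Module.Baer.injective fun I φ => ?_
  -- By finite generation of I, φ has nonzero components only at finitely many indices.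
  obtain ⟨S, hS⟩ : ∃ S : Finset ι, ∀ x i, i ∉ S → φ x i = 0 := by
    obtain ⟨T, hT⟩ : (⊤ : Submodule R I).FG := Module.Finite.fg_top
    refine ⟨T.biUnion fun x => (φ x).support, fun x i hi => ?_⟩
    have : (⊤ : Submodule R I) ≤ LinearMap.ker (DirectSum.component R ι (fun i => E i) i ∘ₗ φ) := by
      rw [← hT, Submodule.span_le]
      intro y hy
      simp only [Finset.mem_biUnion, not_exists, not_and, DFinsupp.mem_support_toFun,
        not_not] at hi
      exact hi y hy
    exact this (Submodule.mem_top (x := x))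
  choose ψ hψ using fun i => Module.Baer.of_injective (hE i) I
    (DirectSum.component R ι (fun i => E i) i ∘ₗ φ)
  refine ⟨∑ i ∈ S, DirectSum.lof R ι (fun i => E i) i ∘ₗ ψ i, fun x hx => ?_⟩
  ext i
  rw [LinearMap.sum_apply, DirectSum.sum_apply]
  by_cases hi : i ∈ S
  · rw [Finset.sum_eq_single i]
    · simp only [LinearMap.comp_apply, hψ i x hx, DirectSum.lof_eq_of, DirectSum.of_eq_same]
      rfl
    · intro j _ hj
      simp only [LinearMap.comp_apply, DirectSum.lof_eq_of]
      exact DirectSum.of_eq_of_ne _ _ _ hj.symm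
    · exact fun h => absurd hi h
  · rw [hS _ _ hi]
    refine Finset.sum_eq_zero fun j hj => ?_
    simp only [LinearMap.comp_apply, DirectSum.lof_eq_of]
    exact DirectSum.of_eq_of_ne _ _ _ (fun h => hi (h ▸ hj))

theorem injective_finsupp {ι : Type u} {E : ModuleCat.{u} R} (hE : Module.Injective R E) :
    Module.Injective R (ι →₀ E) := by
  classical
  exact injective_of_isSummand (N := ModuleCat.of R (ι →₀ E))
    (M := ModuleCat.of R (⨁ _ : ι, E))
    (isSummand_of_equiv (finsuppLEquivDirectSum R E ι)) (injective_directSum fun _ => hE)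

end Injectives

/-! ### Associated primes and Matlis' decomposition -/

section Matlis

variable {R : Type u} [CommRing R]

/-- `Hom(R/𝔭, M) = 0` for every prime `𝔭 ∉ Y`: no nonzero element of `M` is annihilated by a prime
outside `Y`. If `Y` is closed under generalization and `R` is noetherian, this says that
`Ass M ⊆ Y`. -/
def HomZero (Y : Set (PrimeSpectrum R)) (M : Type u) [AddCommGroup M] [Module R M] : Prop :=
  ∀ p ∉ Y, ∀ x : M, (∀ a ∈ p.asIdeal, a • x = 0) → x = 0

variable {Y : Set (PrimeSpectrum R)}

theorem HomZero.of_injective {M N : Type u} [AddCommGroup M] [Module R M] [AddCommGroup N]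
    [Module R N] (h : HomZero Y N) {f : M →ₗ[R] N} (hf : Function.Injective f) : HomZero Y M := by
  intro p hp x hx
  refine (map_eq_zero_iff f hf).1 (h p hp _ fun a ha => ?_)
  rw [← map_smul, hx a ha, map_zero]

theorem homZero_pi {ι : Type u} {M : ι → ModuleCat.{u} R} (h : ∀ i, HomZero Y (M i)) :
    HomZero Y (∀ i, M i) := by
  intro p hp x hx
  ext i
  exact h i p hp _ fun a ha => congrFun (hx a ha) i

theorem homZero_directSum {ι : Type u} {M : ι → ModuleCat.{u} R} (h : ∀ i, HomZero Y (M i)) :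
    HomZero Y (⨁ i, M i) :=
  (homZero_pi h).of_injective (f := DFinsupp.coeFnLinearMap R) DFunLike.coe_injective

theorem homZero_finsupp {ι : Type u} {M : ModuleCat.{u} R} (h : HomZero Y M) :
    HomZero Y (ι →₀ M) :=
  (homZero_pi (M := fun _ : ι => M) fun _ => h).of_injective (f := Finsupp.lcoeFun)
    DFunLike.coe_injective

theorem IsInjectiveHull.homZero {M E : ModuleCat.{u} R} {ι : M →ₗ[R] E}
    (h : IsInjectiveHull ι) (hM : HomZero Y M) : HomZero Y E := by
  intro p hp x hx
  by_contra hne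
  obtain ⟨a, m, hm, ham⟩ := h.exists_smul hne
  refine hm (hM p hp m fun b hb => h.mono ?_)
  rw [map_smul, ham, smul_comm, hx b hb, smul_zero, map_zero]

theorem homZero_primeHull (hY : IsLowerSet Y) {p : PrimeSpectrum R} (hp : p ∈ Y) :
    HomZero Y (primeHull p) := by
  refine (isInjectiveHull_hullMap _).homZero fun q hq x hx => ?_
  obtain ⟨r, rfl⟩ := Ideal.Quotient.mk_surjective x
  have hle : ¬ q.asIdeal ≤ p.asIdeal := fun h => hq (hY h hp)
  obtain ⟨a, haq, hap⟩ := Set.not_subset.1 hle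
  have h0 : Ideal.Quotient.mk p.asIdeal (a * r) = 0 := hx a haq
  rw [Ideal.Quotient.eq_zero_iff_mem] at h0 ⊢
  exact (p.isPrime.mem_or_mem h0).resolve_left hap

theorem extZero_zero_iff_homZero {M : ModuleCat.{u} R} :
    (∀ p ∉ Y, ExtZero (ModuleCat.of R (R ⧸ p.asIdeal)) M 0) ↔ HomZero Y M := by
  refine forall₂_congr fun p _ => ?_
  rw [extZero_zero_iff]
  constructor
  · intro h x hx
    have h1 : (1 : R) • x = 0 :=
      LinearMap.congr_fun (h (Submodule.liftQ p.asIdeal (LinearMap.toSpanSingleton R M x)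
        fun a ha => hx a ha)) (Submodule.Quotient.mk 1)
    rwa [one_smul] at h1
  · intro h f
    ext
    refine h _ fun a ha => ?_
    have h0 : a • Submodule.Quotient.mk (p := p.asIdeal) (1 : R) = 0 := by
      rw [← Submodule.Quotient.mk_smul, Submodule.Quotient.mk_eq_zero]
      simpa using ha
    change a • f (Submodule.Quotient.mk 1) = 0
    rw [← map_smul, h0, map_zero]

theorem injective_primeHull (p : PrimeSpectrum R) : Module.Injective R (primeHull p) :=
  (isInjectiveHull_hullMap _).injective_module

instance (p : PrimeSpectrum R) : Nontrivial (primeHull p) :=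
  (isInjectiveHull_hullMap (ModuleCat.of R (R ⧸ p.asIdeal))).mono.nontrivial

variable [IsNoetherianRing R]

/-- If 𝔮 kills x ≠ 0, then 𝔮 ⊆ Ann x ⊆ P for some associated prime P, and P ∈ Y forces 𝔮 ∈ Y by
closure under generalization. -/
theorem homZero_of_associatedPrimes {M : ModuleCat.{u} R} (hY : IsLowerSet Y)
    (h : ∀ p : PrimeSpectrum R, p.asIdeal ∈ associatedPrimes R M → p ∈ Y) : HomZero Y M := by
  intro q hq x hx
  by_contra hne
  obtain ⟨P, hP, hle⟩ := exists_le_isAssociatedPrime_of_isNoetherianRing R x hne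
  refine hq (hY (a := ⟨P, hP.1⟩) ?_ (h ⟨P, hP.1⟩ hP))
  intro a ha
  exact hle (Submodule.mem_colon_singleton.2 (hx a ha))

/-- A nonzero injective module contains a copy of some `E(R/𝔭)`. -/
theorem exists_primeHull_embedding {E : ModuleCat.{u} R} (hE : Module.Injective R E)
    (hY : HomZero Y E) [Nontrivial E] :
    ∃ p ∈ Y, ∃ f : primeHull p →ₗ[R] E, Function.Injective f := by
  obtain ⟨P, hP⟩ := associatedPrimes.nonempty R E
  have hP' := hP.1
  obtain ⟨f, hf⟩ := ((isAssociatedPrime_iff_exists_injective_linearMap _ _).1 hP).2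
  let p : PrimeSpectrum R := ⟨P, hP'⟩
  have hull := isInjectiveHull_hullMap (ModuleCat.of R (R ⧸ p.asIdeal))
  obtain ⟨g, hg⟩ := hE.out _ hull.mono f
  refine ⟨p, ?_, g, hull.injective_of_comp fun x y h => hf ?_⟩
  · by_contra hp
    have h0 : f 1 = 0 := by
      refine hY p hp _ fun a ha => ?_
      rw [← map_smul]
      have : a • (1 : R ⧸ P) = 0 := by
        rw [← map_one (Ideal.Quotient.mk P)]
        change Ideal.Quotient.mk P (a * 1) = 0
        rw [mul_one, Ideal.Quotient.eq_zero_iff_mem]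
        exact ha
      rw [this, map_zero]
    have h1 : (1 : R ⧸ P) = 0 := hf (by rw [h0, map_zero])
    exact one_ne_zero h1
  · rw [← hg, ← hg]
    exact h

/-- Matlis: over a noetherian ring, an injective module with associated primes in `Y` is a direct
sum of modules `E(R/𝔭)` with `𝔭 ∈ Y`. -/
theorem exists_primeHull_decomposition {E : ModuleCat.{u} R} (hE : Module.Injective R E)
    (hY : HomZero Y E) :
    ∃ (ι : Type u) (p : ι → Y), Nonempty (E ≃ₗ[R] ⨁ i, primeHull (p i).1) := by
  classical
  -- A maximal independent family of copies of E(R/𝔭), 𝔭 ∈ Y. Its sum is injective, hence has a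
  -- complement, and a nonzero complement would contain a further copy.
  obtain ⟨T, hT⟩ := zorn_subset {T : Set (Submodule R E) | sSupIndep T ∧
      ∀ N ∈ T, ∃ p : Y, Nonempty (N ≃ₗ[R] primeHull p.1)} (by
    intro c hc hchain
    refine ⟨⋃₀ c, ⟨iSupIndep_sUnion_of_directed hchain.directedOn fun s hs => (hc hs).1, ?_⟩,
      fun s hs => Set.subset_sUnion_of_mem hs⟩
    rintro N ⟨s, hs, hN⟩
    exact (hc hs).2 N hN)
  choose p e using fun N : T => hT.prop.2 N N.2
  have hind : iSupIndep fun N : T => (N : Submodule R E) := (sSupIndep_iff T).1 hT.prop.1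
  have hinj : Module.Injective R (sSup T : Submodule R E) := by
    rw [sSup_eq_iSup', Submodule.iSup_eq_range_dfinsupp_lsum]
    let F := DFinsupp.lsum ℕ fun N : T => (N : Submodule R E).subtype
    have hF : Function.Injective F := hind.dfinsupp_lsum_injective
    refine injective_of_isSummand (N := ModuleCat.of R (LinearMap.range F))
      (M := ModuleCat.of R (⨁ N : T, primeHull (p N).1))
      (isSummand_of_equiv ((LinearEquiv.ofInjective F hF).symm.trans
        (DFinsupp.mapRange.linearEquiv fun N => (e N).some)))
      (injective_directSum fun N => injective_primeHull _)
  obtain ⟨N', hN'⟩ := exists_isCompl_of_injective _ hinj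
  have htop : sSup T = ⊤ := by
    by_contra hne
    have : Nontrivial N' := by
      rw [Submodule.nontrivial_iff_ne_bot]
      rintro rfl
      exact hne (by simpa using hN'.sup_eq_top)
    obtain ⟨q, hq, f, hf⟩ := exists_primeHull_embedding (E := ModuleCat.of R N')
      (injective_of_isSummand (isSummand_of_isCompl hN'.symm) hE)
      (hY.of_injective N'.injective_subtype)
    have hinj' : Function.Injective (N'.subtype ∘ₗ f) := fun x y h => hf (N'.injective_subtype h)
    let L : Submodule R E := LinearMap.range (N'.subtype ∘ₗ f)
    have hL : L ≤ N' := by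
      rintro _ ⟨x, rfl⟩
      exact (f x).2
    have hLT : L ∈ T := by
      refine hT.2 (y := insert L T) ⟨?_, ?_⟩ (Set.subset_insert _ _) (Set.mem_insert _ _)
      · rintro a (rfl | ha)
        · refine (hN'.disjoint.mono_right hL).symm.mono_right (sSup_le_sSup ?_)
          rintro N ⟨rfl | hN, hN0⟩
          · exact absurd rfl hN0
          · exact hN
        · refine (Disjoint.disjoint_sup_right_of_disjoint_sup_left (hT.prop.1 ha)
            ((hN'.disjoint.mono_right hL).mono_left (sup_le (le_sSup ha)
              (sSup_le_sSup Set.sdiff_subset)))).mono_right (sSup_le ?_)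
          rintro N ⟨rfl | hN, hN0⟩
          · exact le_sup_right
          · exact le_sup_of_le_left (le_sSup ⟨hN, hN0⟩)
      · rintro N (rfl | hN)
        · exact ⟨⟨q, hq⟩, ⟨(LinearEquiv.ofInjective _ hinj').symm⟩⟩
        · exact hT.prop.2 N hN
    have hL0 : L = ⊥ := by
      rw [eq_bot_iff, ← hN'.inf_eq_bot]
      exact le_inf (le_sSup hLT) hL
    have hf0 : N'.subtype ∘ₗ f = 0 := LinearMap.range_eq_bot.1 hL0
    obtain ⟨x, hx⟩ := exists_ne (0 : primeHull q)
    refine hx (hinj' ?_)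
    rw [hf0]
    rfl
  refine ⟨T, p, ⟨?_⟩⟩
  have hint := DirectSum.isInternal_submodule_of_iSupIndep_of_iSup_eq_top hind
    (by rw [← sSup_eq_iSup', htop])
  exact (LinearEquiv.ofBijective (DirectSum.coeLinearMap _) hint).symm.trans
    (DFinsupp.mapRange.linearEquiv fun N => (e N).some)

end Matlis

/-! ### The class I(Y), its precovers and covers -/

section InjClass

variable {R : Type u} [CommRing R] {Y : Set (PrimeSpectrum R)}

theorem injClass_of_isSummand {N M : ModuleCat.{u} R} (h : IsSummand N M) (hM : injClass Y M) :
    injClass Y N :=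
  hM.imp fun _ hI => h.trans hI

theorem injClass_directSum {ι : Type u} (p : ι → Y) :
    injClass Y (ModuleCat.of R (⨁ i, primeHull (p i).1)) := by
  classical
  refine ⟨ι,
    DirectSum.toModule R ι _ fun i => Finsupp.lsingle i ∘ₗ
      DirectSum.lof R Y (fun q => primeHull q.1) (p i),
    Finsupp.lsum R fun i => DirectSum.lof R ι (fun i => primeHull (p i).1) i ∘ₗ
      DirectSum.component R Y (fun q => primeHull q.1) (p i), ?_⟩
  refine DirectSum.linearMap_ext _ fun i => ?_
  ext x : 1
  simp [DirectSum.component.lof_self]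

/-- The sum of all maps E(R/𝔭) → M with 𝔭 ∈ Y is a precover: a map from a direct sum of such hulls
factors summand by summand, and a summand inherits this. -/
theorem exists_injClass_precover (M : ModuleCat.{u} R) :
    ∃ (D : ModuleCat.{u} R) (f : D →ₗ[R] M), IsPrecover (injClass Y) f := by
  classical
  let ι := Σ p : Y, primeHull p.1 →ₗ[R] M
  refine ⟨_, DirectSum.toModule R ι M fun i => i.2, injClass_directSum fun i : ι => i.1, ?_⟩
  rintro D' ⟨I, s, r, hrs⟩ f'
  let φ : (I →₀ ⨁ p : Y, primeHull p.1) →ₗ[R] ⨁ i : ι, primeHull i.1.1 :=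
    Finsupp.lsum R fun i => DirectSum.toModule R Y _ fun p =>
      DirectSum.lof R ι (fun i => primeHull i.1.1)
        ⟨p, f' ∘ₗ r ∘ₗ Finsupp.lsingle i ∘ₗ DirectSum.lof R Y (fun q => primeHull q.1) p⟩
  have hφ : DirectSum.toModule R ι M (fun i => i.2) ∘ₗ φ = f' ∘ₗ r := by
    refine Finsupp.lhom_ext' fun i => DirectSum.linearMap_ext _ fun p => ?_
    ext x : 1
    simp [φ]
  refine ⟨φ ∘ₗ s, ?_⟩
  rw [← LinearMap.comp_assoc, hφ, LinearMap.comp_assoc, hrs, LinearMap.comp_id]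

/-- A map from an injective module whose kernel contains no nonzero injective submodule is right
minimal. -/
theorem bijective_of_comp_eq {D M : ModuleCat.{u} R} (hD : Module.Injective R D) {f : D →ₗ[R] M}
    (hf : ∀ N ≤ LinearMap.ker f, Module.Injective R N → N = ⊥) {g : D →ₗ[R] D}
    (hg : f = f ∘ₗ g) : Function.Bijective g := by
  let h : D →ₗ[R] D := LinearMap.id - g
  have hfh : f ∘ₗ h = 0 := by
    rw [LinearMap.comp_sub, ← hg, LinearMap.comp_id, sub_self]
  have hmem : ∀ x ∈ LinearMap.ker h, g x = x := fun x hx => (sub_eq_zero.1 hx).symm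
  -- Ker(1 - g) is essential: if L meets it trivially, 1 - g embeds E(L) into Ker f, which contains
  -- no nonzero injective.
  have hess : ∀ L : Submodule R D, Disjoint L (LinearMap.ker h) → L = ⊥ := by
    intro L hL
    have hull := isInjectiveHull_hullMap (ModuleCat.of R L)
    obtain ⟨j, hj⟩ := hD.out _ hull.mono L.subtype
    have hinj : Function.Injective (h ∘ₗ j) := by
      refine hull.injective_of_comp ?_
      rw [← LinearMap.ker_eq_bot, Submodule.eq_bot_iff]
      intro x hx
      have hx' : h x = 0 := by
        rw [← hx]
        exact congrArg h (hj x).symm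
      exact Subtype.ext (Submodule.disjoint_def.1 hL x x.2 hx')
    have hbot := hf (LinearMap.range (h ∘ₗ j))
      (by
        rintro _ ⟨x, rfl⟩
        exact LinearMap.congr_fun hfh (j x))
      (injective_of_isSummand (N := ModuleCat.of R (LinearMap.range (h ∘ₗ j)))
        (isSummand_of_equiv (LinearEquiv.ofInjective _ hinj).symm) hull.injective_module)
    rw [Submodule.eq_bot_iff]
    intro x hx
    have hx0 : hullMap (ModuleCat.of R L) ⟨x, hx⟩ = 0 := by
      refine hinj ?_
      rw [LinearMap.range_eq_bot.1 hbot]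
      rfl
    exact congrArg Subtype.val (hull.mono (hx0.trans (map_zero _).symm))
  have hginj : Function.Injective g := by
    rw [← LinearMap.ker_eq_bot]
    refine hess _ (Submodule.disjoint_def.2 fun x hx hx' => ?_)
    rw [← hmem x hx']
    exact hx
  refine ⟨hginj, ?_⟩
  obtain ⟨N', hN'⟩ := exists_isCompl_of_injective (LinearMap.range g)
    (injective_of_isSummand (N := ModuleCat.of R (LinearMap.range g))
      (isSummand_of_equiv (LinearEquiv.ofInjective _ hginj).symm) hD)
  -- Im g contains the essential submodule Ker(1 - g), so its complement vanishes.
  have : N' = ⊥ := hess _ (hN'.disjoint.symm.mono_right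
    (show LinearMap.ker h ≤ LinearMap.range g from fun x hx => ⟨x, hmem x hx⟩))
  subst this
  rw [← LinearMap.range_eq_top]
  simpa using hN'.sup_eq_top

variable [IsNoetherianRing R]

theorem injective_of_injClass {D : ModuleCat.{u} R} (h : injClass Y D) : Module.Injective R D := by
  obtain ⟨I, hI⟩ := h
  exact injective_of_isSummand hI (injective_finsupp (E := ModuleCat.of R _)
    (injective_directSum fun p => injective_primeHull _))

theorem injClass_iff (hY : IsLowerSet Y) {D : ModuleCat.{u} R} :
    injClass Y D ↔ Module.Injective R D ∧ HomZero Y D := by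
  constructor
  · intro h
    refine ⟨injective_of_injClass h, ?_⟩
    obtain ⟨I, s, r, hrs⟩ := h
    refine HomZero.of_injective (f := s) ?_
      (Function.LeftInverse.injective (LinearMap.congr_fun hrs))
    exact homZero_finsupp (M := ModuleCat.of R (⨁ p : Y, primeHull p.1))
      (homZero_directSum fun p => homZero_primeHull hY p.2)
  · rintro ⟨h, h'⟩
    obtain ⟨ι, p, ⟨e⟩⟩ := exists_primeHull_decomposition h h'
    exact injClass_of_isSummand (isSummand_of_equiv e) (injClass_directSum p)

theorem homZero_iff_exists_equiv (hY : IsLowerSet Y) {E : ModuleCat.{u} R}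
    (hE : Module.Injective R E) :
    HomZero Y E ↔ ∃ I : Y → Type u, Nonempty (E ≃ₗ[R] ⨁ p : Y, (I p →₀ primeHull p.1)) := by
  classical
  constructor
  · intro h
    obtain ⟨ι, p, ⟨e⟩⟩ := exists_primeHull_decomposition hE h
    let F : (⨁ i, primeHull (p i).1) →ₗ[R] ⨁ q : Y, ({i : ι // p i = q} →₀ primeHull q.1) :=
      DirectSum.toModule R ι _ fun i => DirectSum.lof R Y
        (fun q => {i : ι // p i = q} →₀ primeHull q.1) (p i) ∘ₗ Finsupp.lsingle ⟨i, rfl⟩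
    let G : (⨁ q : Y, ({i : ι // p i = q} →₀ primeHull q.1)) →ₗ[R] ⨁ i, primeHull (p i).1 :=
      DirectSum.toModule R Y _ fun q => Finsupp.lsum R fun i : {i : ι // p i = q} =>
        -- The inclusion of the summand at i, transported along `p i = q`.
        i.2 ▸ DirectSum.lof R ι (fun i => primeHull (p i).1) i.1
    have hFG : F ∘ₗ G = LinearMap.id := by
      refine DirectSum.linearMap_ext _ fun q => Finsupp.lhom_ext' ?_
      rintro ⟨i, rfl⟩
      ext x : 1
      simp [F, G]
    have hGF : G ∘ₗ F = LinearMap.id := by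
      refine DirectSum.linearMap_ext _ fun i => ?_
      ext x : 1
      simp [F, G]
    let e' : (⨁ i, primeHull (p i).1) ≃ₗ[R] ⨁ q : Y, ({i : ι // p i = q} →₀ primeHull q.1) :=
      LinearEquiv.ofLinearMap F G hFG hGF
    exact ⟨fun q => {i : ι // p i = q}, ⟨e.trans e'⟩⟩
  · rintro ⟨I, ⟨e⟩⟩
    refine HomZero.of_injective (f := e.toLinearMap) ?_ e.injective
    exact homZero_directSum (M := fun p : Y => ModuleCat.of R (I p →₀ primeHull p.1))
      fun p => homZero_finsupp (homZero_primeHull hY p.2)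

/-- Split off a maximal injective submodule L of the kernel of a precover. The restriction to a
complement is still a precover, and its kernel has no nonzero injective submodule, so it is right
minimal. -/
theorem exists_injClass_cover (Y : Set (PrimeSpectrum R)) (M : ModuleCat.{u} R) :
    ∃ (D : ModuleCat.{u} R) (f : D →ₗ[R] M), IsCover (injClass Y) f := by
  obtain ⟨D, f, hD, hf⟩ := exists_injClass_precover (Y := Y) M
  have hDinj := injective_of_injClass hD
  obtain ⟨L, -, hL⟩ := zorn_le_nonempty₀
    {L : Submodule R D | L ≤ LinearMap.ker f ∧ Module.Injective R L}
    (fun c hc hchain N₀ hN₀ => ⟨sSup c, ⟨sSup_le fun N hN => (hc hN).1,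
      injective_sSup ⟨N₀, hN₀⟩ hchain.directedOn fun N hN => (hc hN).2⟩, fun _ => le_sSup⟩)
    ⊥ ⟨bot_le, ⟨fun _ _ _ _ _ _ _ _ _ => ⟨0, fun _ => Subsingleton.elim _ _⟩⟩⟩
  obtain ⟨D₁, hD₁⟩ := exists_isCompl_of_injective L hL.prop.2
  have hsum : IsSummand (ModuleCat.of R D₁) D := isSummand_of_isCompl hD₁.symm
  refine ⟨ModuleCat.of R D₁, f ∘ₗ D₁.subtype, ⟨injClass_of_isSummand hsum hD, ?_⟩, ?_⟩
  · intro D' hD' f'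
    obtain ⟨g, rfl⟩ := hf D' hD' f'
    refine ⟨D₁.projectionOnto L hD₁.symm ∘ₗ g, ?_⟩
    ext x
    have hx := Submodule.projection_add_projection_eq_self hD₁ (g x)
    have hx0 : f (L.projection D₁ hD₁ (g x)) = 0 :=
      hL.prop.1 (Submodule.projection_apply_mem hD₁ (g x))
    calc f (g x) = f (L.projection D₁ hD₁ (g x) + D₁.projection L hD₁.symm (g x)) := by rw [hx]
      _ = f (D₁.projection L hD₁.symm (g x)) := by rw [map_add, hx0, zero_add]
  · intro g hg
    refine bijective_of_comp_eq (injective_of_isSummand hsum hDinj) (fun N hN hNinj => ?_) hg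
    -- L ⊕ N is again an injective submodule of Ker f, so N = 0 by maximality of L.
    let φ : (L × N) →ₗ[R] D := L.subtype.coprod (D₁.subtype ∘ₗ N.subtype)
    have hφ : Function.Injective φ := by
      rw [← LinearMap.ker_eq_bot, Submodule.eq_bot_iff]
      rintro ⟨x, y⟩ hxy
      have hxy' : (x : D) + ((y : D₁) : D) = 0 := hxy
      have hx : (x : D) = 0 := by
        refine Submodule.disjoint_def.1 hD₁.disjoint _ x.2 ?_
        rw [eq_neg_of_add_eq_zero_left hxy']
        exact D₁.neg_mem (y : D₁).2
      rw [hx, zero_add] at hxy'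
      exact Prod.ext (Subtype.ext hx) (Subtype.ext (Subtype.ext hxy'))
    have hle : LinearMap.range φ ≤ L := by
      refine hL.2 ⟨?_, ?_⟩ fun x hx => ⟨(⟨x, hx⟩, 0), by simp [φ]⟩
      · rintro _ ⟨⟨x, y⟩, rfl⟩
        have h1 : f x = 0 := hL.prop.1 x.2
        have h2 : f (y : D₁) = 0 := hN y.2
        simpa [φ, h1] using h2
      · exact injective_of_isSummand (N := ModuleCat.of R (LinearMap.range φ))
          (M := ModuleCat.of R (L × N))
          (isSummand_of_equiv (LinearEquiv.ofInjective φ hφ).symm)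
          (injective_prod (N := ModuleCat.of R L) (M := ModuleCat.of R N) hL.prop.2 hNinj)
    rw [Submodule.eq_bot_iff]
    intro y hy
    exact Subtype.ext (Submodule.disjoint_def.1 hD₁.disjoint _
      (hle ⟨(0, ⟨y, hy⟩), by simp [φ]⟩) (y : D₁).2)

end InjClass

/-! ### The class defined by vanishing of Extⁱ(R/𝔭, -) -/

section ExtClass

variable {R : Type u} [CommRing R] {Y : ℕ → Set (PrimeSpectrum R)}

/-- The modules `X` with `Extⁱ(R/𝔭, X) = 0` for all `i` and all primes `𝔭 ∉ Y_i`. -/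
def extClass (Y : ℕ → Set (PrimeSpectrum R)) : ObjectProperty (ModuleCat.{u} R) := fun X =>
  ∀ (i : ℕ), ∀ p ∉ Y i, ExtZero (ModuleCat.of R (R ⧸ p.asIdeal)) X i

theorem extClass.homZero {X : ModuleCat.{u} R} (h : extClass Y X) : HomZero (Y 0) X :=
  extZero_zero_iff_homZero.1 (h 0)

theorem extClass.mono {Y' : ℕ → Set (PrimeSpectrum R)} (hY : ∀ i, Y i ⊆ Y' i)
    {X : ModuleCat.{u} R} (h : extClass Y X) : extClass Y' X :=
  fun i p hp => h i p fun h' => hp (hY i h')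

theorem extClass_pi {ι : Type u} {X : ι → ModuleCat.{u} R} (h : ∀ j, extClass Y (X j)) :
    extClass Y (ModuleCat.of R (∀ j, X j)) :=
  fun i p hp => extZero_pi fun j => h j i p hp

theorem extClass_of_injective {X : ModuleCat.{u} R} (hX : Module.Injective R X)
    (h : HomZero (Y 0) X) : extClass Y X := by
  rintro (_ | i) p hp
  · exact extZero_zero_iff_homZero.2 h p hp
  · exact extZero_of_injective _ hX i

theorem extClass.coker (hY : Monotone Y) {A B C : ModuleCat.{u} R} {f : A →ₗ[R] B} {g : B →ₗ[R] C}
    (h : IsShortExact f g) (hA : extClass Y A) (hB : extClass Y B) :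
    extClass (fun i => Y (i + 1)) C :=
  fun i p hp => h.extZero_right (hB i p fun h' => hp (hY (Nat.le_succ i) h')) (hA (i + 1) p hp)

theorem extClass.ker {A B C : ModuleCat.{u} R} {f : A →ₗ[R] B} {g : B →ₗ[R] C}
    (h : IsShortExact f g) (hB : extClass Y B) (hC : extClass (fun i => Y (i + 1)) C) :
    extClass Y A := by
  rintro (_ | i) p hp
  · exact extZero_zero_iff_homZero.2 (hB.homZero.of_injective h.injective) p hp
  · exact h.extZero_left (hC i p hp) (hB (i + 1) p hp)

theorem extClass.hull {X : ModuleCat.{u} R} (h : extClass Y X) : extClass Y (injectiveHull X) :=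
  extClass_of_injective (isInjectiveHull_hullMap X).injective_module
    ((isInjectiveHull_hullMap X).homZero h.homZero)

theorem isShortExact_hull (X : ModuleCat.{u} R) :
    IsShortExact (C := ModuleCat.of R (injectiveHull X ⧸ LinearMap.range (hullMap X)))
      (hullMap X) (LinearMap.range (hullMap X)).mkQ :=
  isShortExact_coker (isInjectiveHull_hullMap X).mono

theorem extClass_iff_homZero_cosyzygy (hY : Monotone Y) {X : ModuleCat.{u} R} :
    extClass Y X ↔ ∀ i, HomZero (Y i) (cosyzygy X i) := by
  constructor
  · intro h
    -- Each cosyzygy lies in the correspondingly shifted class; this stronger form is what the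
    -- induction carries.
    suffices ∀ i, extClass (fun j => Y (j + i)) (cosyzygy X i) from
      fun i => by simpa using (this i).homZero
    intro i
    induction i with
    | zero => exact h
    | succ i ih =>
      have := ih.coker (fun a b hab => hY (Nat.add_le_add_right hab i))
        (isShortExact_hull _) ih.hull
      exact this.mono fun j => by rw [Nat.add_right_comm, Nat.add_assoc]
  · intro h
    suffices ∀ m i p, p ∉ Y (m + i) →
        ExtZero (ModuleCat.of R (R ⧸ p.asIdeal)) (cosyzygy X i) m from fun i p hp => this i 0 p hp
    intro m
    induction m with
    | zero =>
      intro i p hp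
      exact extZero_zero_iff_homZero.2 (h i) p (by simpa using hp)
    | succ m ih =>
      intro i p hp
      refine (isShortExact_hull (cosyzygy X i)).extZero_left (ih (i + 1) p ?_)
        (extZero_of_injective _ (isInjectiveHull_hullMap _).injective_module m)
      rwa [← Nat.add_assoc, Nat.add_right_comm]

/-- By essentiality, the Hom-vanishing conditions for ℧ⁱX and for its hull are equivalent; for the
hull, Matlis' theorem rewrites them as a decomposition. -/
theorem extClass_eq_cotiltClass [IsNoetherianRing R] (hY : Monotone Y)
    (hgen : ∀ i, IsLowerSet (Y i)) : extClass Y = cotiltClass Y := by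
  ext X
  rw [extClass_iff_homZero_cosyzygy hY]
  refine forall_congr' fun i => ?_
  have hull := isInjectiveHull_hullMap (cosyzygy X i)
  rw [← homZero_iff_exists_equiv (hgen i) hull.injective_module]
  exact ⟨fun h => hull.homZero h, fun h => h.of_injective hull.mono⟩

/-- The terms `C₀, …, C_{n-1}` of an exact sequence `0 → M → C₀ → C₁ → ⋯` control
`Extⁱ(R/𝔭, M)` for `i < n`. -/
theorem extZero_of_exact (hY : Monotone Y) {i : ℕ} {p : PrimeSpectrum R} (hp : p ∉ Y i)
    {M : ModuleCat.{u} R} {D : ℕ → ModuleCat.{u} R} {ι : M →ₗ[R] D 0}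
    {d : ∀ i, D i →ₗ[R] D (i + 1)} (hι : Function.Injective ι) (hι0 : Function.Exact ι (d 0))
    (hd : ∀ i, Function.Exact (d i) (d (i + 1))) (hD : ∀ j ≤ i, extClass Y (D j)) :
    ExtZero (ModuleCat.of R (R ⧸ p.asIdeal)) M i := by
  induction i generalizing M D with
  | zero =>
    exact extZero_zero_iff_homZero.2 ((hD 0 le_rfl).homZero.of_injective hι) p hp
  | succ i ih =>
    have hex : IsShortExact (C := ModuleCat.of R (LinearMap.range (d 0))) ι (d 0).rangeRestrict :=
      ⟨hι, fun x => by rw [← hι0 x]; exact Subtype.ext_iff, (d 0).surjective_rangeRestrict⟩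
    refine hex.extZero_left (ih (fun h => hp (hY (Nat.le_succ i) h))
      (D := fun j => D (j + 1)) (d := fun j => d (j + 1)) (ι := (LinearMap.range (d 0)).subtype)
      Subtype.val_injective ?_ (fun j => hd (j + 1)) fun j hj => hD (j + 1) (Nat.succ_le_succ hj))
      (hD 0 (Nat.zero_le _) _ p hp)
    intro x
    rw [hd 0 x]
    simp

end ExtClass

/-! ### Existence of the iterated covers -/

section Existence

variable {R : Type u} [CommRing R] [IsNoetherianRing R]

theorem exists_iterated_covers (k : ℕ) (Y : ℕ → Set (PrimeSpectrum R)) (M : ModuleCat.{u} R) :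
    ∃ (K E : ℕ → ModuleCat.{u} R) (ν : ∀ j, K j →ₗ[R] E j) (Φ : ∀ j, E j →ₗ[R] K (j + 1)),
      Nonempty (K k ≃ₗ[R] M) ∧ ∀ j < k, IsCover (injClass (Y j)) (Φ j) ∧
        Function.Injective (ν j) ∧ Function.Exact (ν j) (Φ j) := by
  induction k generalizing Y with
  | zero =>
    exact ⟨fun _ => M, fun _ => M, fun _ => 0, fun _ => 0, ⟨LinearEquiv.refl R M⟩,
      fun j hj => absurd hj (Nat.not_lt_zero j)⟩
  | succ k ih =>
    -- The construction runs from the top down, so the induction uses the shifted sequence and adds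
    -- the cover at index 0 last.
    obtain ⟨K, E, ν, Φ, hK, h⟩ := ih fun j => Y (j + 1)
    obtain ⟨D, f, hf⟩ := exists_injClass_cover (Y 0) (K 0)
    refine ⟨fun j => Nat.casesOn j (ModuleCat.of R (LinearMap.ker f)) K,
      fun j => Nat.casesOn j D E, fun j => Nat.casesOn j (LinearMap.ker f).subtype ν,
      fun j => Nat.casesOn j f Φ, hK, ?_⟩
    rintro (_ | j) hj
    · exact ⟨hf, Subtype.val_injective, LinearMap.exact_subtype_ker_map f⟩
    · exact h j (Nat.lt_of_succ_lt_succ hj)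

theorem exists_precoverComplex_byCovers {Y : ℕ → Set (PrimeSpectrum R)} {n : ℕ}
    (hYn : Y n = Set.univ) (p : PrimeSpectrum R) : ∃ D : PrecoverComplex Y p, D.ByCovers := by
  classical
  have hex : ∃ j, p ∈ Y j := ⟨n, hYn ▸ Set.mem_univ p⟩
  obtain ⟨K, E, ν, Φ, ⟨e⟩, h⟩ := exists_iterated_covers (Nat.find hex) Y (primeHull p)
  exact ⟨⟨Nat.find hex, ⟨Nat.find_spec hex, fun j hj => Nat.find_min' hex hj⟩, K, E, ν, Φ, e,
    fun j hj => (h j hj).1.1, fun j hj => (h j hj).2.1, fun j hj => (h j hj).2.2⟩,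
    fun j hj => (h j hj).1⟩

end Existence

/-! ### Exactness of the precover complex and Ext into its kernels -/

namespace PrecoverComplex

variable {R : Type u} [CommRing R] {Y : ℕ → Set (PrimeSpectrum R)} {p : PrimeSpectrum R}
  (D : PrecoverComplex Y p)

theorem injective_top : Module.Injective R (D.K D.k) :=
  injective_of_isSummand (isSummand_of_equiv D.top) (injective_primeHull p)

variable [IsNoetherianRing R]

theorem injective_E {i : ℕ} (hi : i < D.k) : Module.Injective R (D.E i) :=
  injective_of_injClass (D.isPrecover i hi).1

/-- The map extends to E(X) because Ext¹(E(X)/X, K_{i+1}) = 0; as E(X) is in I(Y_i), the extension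
factors through the precover. -/
theorem exists_lift (hmono : Monotone Y) (hgen : ∀ i, IsLowerSet (Y i)) {i : ℕ} (hi : i < D.k)
    (hext : ∀ X, extClass (fun j => Y (j + (i + 1))) X → ExtZero X (D.K (i + 1)) 1)
    {X : ModuleCat.{u} R} (hX : extClass (fun j => Y (j + i)) X) (φ : X →ₗ[R] D.K (i + 1)) :
    ∃ ψ : X →ₗ[R] D.E i, D.Φ i ∘ₗ ψ = φ := by
  have hcoker := hX.coker (fun a b hab => hmono (Nat.add_le_add_right hab i)) (isShortExact_hull X)
    hX.hull
  obtain ⟨φ', rfl⟩ := (isShortExact_hull X).exists_extend (hext _ (hcoker.mono fun j => by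
    rw [Nat.add_right_comm, Nat.add_assoc])) φ
  have hE : injClass (Y i) (injectiveHull X) := (injClass_iff (hgen i)).2
    ⟨(isInjectiveHull_hullMap X).injective_module, by simpa using hX.hull.homZero⟩
  obtain ⟨g, rfl⟩ := (D.isPrecover i hi).2 _ hE φ'
  exact ⟨g ∘ₗ hullMap X, rfl⟩

variable (hmono : Monotone Y) (hgen : ∀ i, IsLowerSet (Y i))
  (hR : extClass Y (ModuleCat.of R R))

include hmono hgen hR

/-- Lifting maps out of R is lifting elements: this is where membership of R in the class enters. -/
theorem isShortExact_of_extZero {i : ℕ} (hi : i < D.k)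
    (hext : ∀ X, extClass (fun j => Y (j + (i + 1))) X → ExtZero X (D.K (i + 1)) 1) :
    IsShortExact (D.ν i) (D.Φ i) := by
  refine ⟨D.ν_injective i hi, D.ν_exact i hi, fun x => ?_⟩
  obtain ⟨ψ, hψ⟩ := D.exists_lift hmono hgen hi hext
    (hR.mono fun j => hmono (Nat.le_add_right j i)) (LinearMap.toSpanSingleton R _ x)
  refine ⟨ψ (1 : R), ?_⟩
  have := LinearMap.congr_fun hψ (1 : R)
  simpa only [LinearMap.comp_apply, LinearMap.toSpanSingleton_apply, one_smul] using this

/-- Descending induction from the injective K_k. Ext¹ vanishes by lifting maps through Φ_i; higher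
degrees shift to K_{i+1}, for which the condition on X is weaker. -/
theorem extZero_K {i : ℕ} (hi : i ≤ D.k) {X : ModuleCat.{u} R}
    (hX : extClass (fun j => Y (j + i)) X) (m : ℕ) : ExtZero X (D.K i) (m + 1) := by
  induction hi using Nat.decreasingInduction generalizing X m with
  | self => exact extZero_of_injective _ D.injective_top m
  | of_succ i hi ih =>
    have hE := extZero_of_injective X (D.injective_E hi)
    have hses := D.isShortExact_of_extZero hmono hgen hR hi fun X hX => ih hX 0
    cases m with
    | zero =>
      exact hses.extZero_one_left (hE 0)
        (D.exists_lift hmono hgen hi (fun X hX => ih hX 0) hX)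
    | succ m =>
      exact hses.extZero_left (ih (hX.mono fun j => hmono (Nat.le_succ _)) m) (hE _)

theorem isShortExact {i : ℕ} (hi : i < D.k) : IsShortExact (D.ν i) (D.Φ i) :=
  D.isShortExact_of_extZero hmono hgen hR hi fun _ hX => D.extZero_K hmono hgen hR hi hX 0

theorem extClass_K {i : ℕ} (hi : i ≤ D.k) : extClass (fun j => Y (j + i)) (D.K i) := by
  induction hi using Nat.decreasingInduction with
  | self =>
    refine extClass_of_injective D.injective_top ?_
    rw [zero_add]
    exact (homZero_primeHull (hgen _) D.isLeast_k.1).of_injective (f := D.top.toLinearMap)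
      D.top.injective
  | of_succ i hi ih =>
    refine extClass.ker (D.isShortExact hmono hgen hR hi)
      (extClass_of_injective (D.injective_E hi) ?_)
      (ih.mono fun j => by rw [Nat.add_right_comm, Nat.add_assoc])
    rw [zero_add]
    exact ((injClass_iff (hgen i)).1 (D.isPrecover i hi).1).2

/-- K_i has the injective coresolution E_i, …, E_{k-1}, E(R/𝔭) of length k - i. -/
theorem extZero_K_of_le {i : ℕ} (hi : i ≤ D.k) (X : ModuleCat.{u} R) {m : ℕ}
    (hm : D.k ≤ m + i) : ExtZero X (D.K i) (m + 1) := by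
  induction hi using Nat.decreasingInduction generalizing m with
  | self => exact extZero_of_injective _ D.injective_top m
  | of_succ i hi ih =>
    obtain ⟨m, rfl⟩ : ∃ l, m = l + 1 := ⟨m - 1, by omega⟩
    exact (D.isShortExact hmono hgen hR hi).extZero_left (ih (by omega))
      (extZero_of_injective X (D.injective_E hi) _)

end PrecoverComplex

/-! ### Closure properties of Prod C -/

section ProdClass

variable {R : Type u} [CommRing R] {C : ModuleCat.{u} R}

theorem prodClass_pi {ι : Type u} {D : ι → ModuleCat.{u} R} (h : ∀ i, prodClass C (D i)) :
    prodClass C (ModuleCat.of R (∀ i, D i)) := by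
  choose I hI using h
  exact ⟨Σ i, I i, (isSummand_pi hI).trans
    ⟨LinearMap.pi fun q => LinearMap.proj q.2 ∘ₗ LinearMap.proj q.1,
      LinearMap.pi fun i => LinearMap.pi fun j => LinearMap.proj (⟨i, j⟩ : Σ i, I i), rfl⟩⟩

theorem prodClass_of_subsingleton {D : ModuleCat.{u} R} [Subsingleton D] : prodClass C D :=
  ⟨PEmpty, 0, 0, by ext x; exact Subsingleton.elim _ _⟩

theorem prodClass_prod {A B : ModuleCat.{u} R} (hA : prodClass C A) (hB : prodClass C B) :
    prodClass C (ModuleCat.of R (A × B)) := by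
  obtain ⟨I, s, r, h⟩ := hA
  obtain ⟨J, s', r', h'⟩ := hB
  refine ⟨I ⊕ J, LinearMap.pi fun k => Sum.elim
    (fun i => LinearMap.proj i ∘ₗ s ∘ₗ LinearMap.fst R A B)
    (fun j => LinearMap.proj j ∘ₗ s' ∘ₗ LinearMap.snd R A B) k,
    (r ∘ₗ LinearMap.pi fun i => LinearMap.proj (Sum.inl i)).prod
      (r' ∘ₗ LinearMap.pi fun j => LinearMap.proj (Sum.inr j)), LinearMap.ext fun x => ?_⟩
  exact Prod.ext (LinearMap.congr_fun h x.1) (LinearMap.congr_fun h' x.2)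

theorem extZero_of_prodClass {X D : ModuleCat.{u} R} (hX : leftPerp C X) (hD : prodClass C D)
    (i : ℕ) : ExtZero X D (i + 1) := by
  obtain ⟨I, hI⟩ := hD
  exact ExtZero.of_isSummand (extZero_pi fun _ => hX (i + 1) (Nat.succ_pos i)) hI

end ProdClass

/-! ### Finite resolutions by Prod C -/

section Resolutions

variable {R : Type u} [CommRing R]

/-- Modules with a resolution of length less than `m` by modules in `Prod C`. -/
def prodRes (C : ModuleCat.{u} R) : ℕ → ObjectProperty (ModuleCat.{u} R)
  | 0 => fun M => Subsingleton M
  | m + 1 => fun M => ∃ (D K : ModuleCat.{u} R) (f : K →ₗ[R] D) (g : D →ₗ[R] M),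
      IsShortExact f g ∧ prodClass C D ∧ prodRes C m K

variable {C : ModuleCat.{u} R}

theorem prodRes_zero {M : ModuleCat.{u} R} [Subsingleton M] (m : ℕ) : prodRes C m M := by
  induction m generalizing M with
  | zero => assumption
  | succ m ih =>
    exact ⟨M, M, 0, 0, ⟨Function.injective_of_subsingleton _, fun x => by
      simp [Subsingleton.elim x 0], fun x => ⟨0, Subsingleton.elim _ _⟩⟩,
      prodClass_of_subsingleton, ih⟩

theorem prodRes_succ {m : ℕ} {M : ModuleCat.{u} R} (h : prodRes C m M) : prodRes C (m + 1) M := by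
  induction m generalizing M with
  | zero =>
    have : Subsingleton M := h
    exact prodRes_zero 1
  | succ m ih =>
    obtain ⟨D, K, f, g, hfg, hD, hK⟩ := h
    exact ⟨D, K, f, g, hfg, hD, ih hK⟩

theorem prodRes_mono {m m' : ℕ} (hm : m ≤ m') {M : ModuleCat.{u} R} (h : prodRes C m M) :
    prodRes C m' M := by
  induction hm with
  | refl => exact h
  | step _ ih => exact prodRes_succ ih

theorem prodRes_of_prodClass {M : ModuleCat.{u} R} (h : prodClass C M) : prodRes C 1 M :=
  ⟨M, ModuleCat.of R PUnit, 0, LinearMap.id, ⟨Function.injective_of_subsingleton _, fun x =>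
    ⟨fun hx => ⟨0, by simpa using (show x = 0 from hx).symm⟩, by rintro ⟨y, rfl⟩; simp⟩,
    Function.surjective_id⟩, h, inferInstanceAs (Subsingleton PUnit)⟩

theorem prodRes_of_equiv {m : ℕ} {M N : ModuleCat.{u} R} (e : M ≃ₗ[R] N) (h : prodRes C m M) :
    prodRes C m N := by
  cases m with
  | zero =>
    have : Subsingleton M := h
    exact e.symm.toEquiv.subsingleton
  | succ m =>
    obtain ⟨D, K, f, g, hfg, hD, hK⟩ := h
    exact ⟨D, K, f, e.toLinearMap ∘ₗ g, ⟨hfg.injective, fun x => by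
      simpa using hfg.exact x, e.surjective.comp hfg.surjective⟩, hD, hK⟩

theorem prodRes_pi {m : ℕ} {ι : Type u} {M : ι → ModuleCat.{u} R} (h : ∀ i, prodRes C m (M i)) :
    prodRes C m (ModuleCat.of R (∀ i, M i)) := by
  induction m generalizing M with
  | zero =>
    have : ∀ i, Subsingleton (M i) := h
    exact inferInstanceAs (Subsingleton (∀ i, M i))
  | succ m ih =>
    choose D K f g hfg hD hK using h
    refine ⟨_, _, LinearMap.pi fun i => f i ∘ₗ LinearMap.proj i,
      LinearMap.pi fun i => g i ∘ₗ LinearMap.proj i, ⟨?_, ?_, ?_⟩, prodClass_pi hD, ih hK⟩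
    · intro x y hxy
      ext i
      exact (hfg i).injective (congrFun hxy i)
    · intro x
      constructor
      · intro hx
        choose y hy using fun i => ((hfg i).exact (x i)).1 (congrFun hx i)
        exact ⟨y, funext hy⟩
      · rintro ⟨y, rfl⟩
        ext i
        exact (hfg i).exact.apply_apply_eq_zero (y i)
    · intro x
      choose y hy using fun i => (hfg i).surjective (x i)
      exact ⟨y, funext hy⟩

theorem extZero_of_prodRes {m : ℕ} {X M : ModuleCat.{u} R} (hX : leftPerp C X)
    (h : prodRes C m M) (i : ℕ) : ExtZero X M (i + 1) := by
  induction m generalizing M i with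
  | zero =>
    have : Subsingleton M := h
    exact extZero_of_injective _ ⟨fun _ _ _ _ _ _ _ _ _ => ⟨0, fun _ => Subsingleton.elim _ _⟩⟩ i
  | succ m ih =>
    obtain ⟨D, K, f, g, hfg, hD, hK⟩ := h
    exact hfg.extZero_right (extZero_of_prodClass hX hD i) (ih hK (i + 1))

theorem leftPerp_of_prodClass (hC : ∀ κ : Type u, leftPerp C (ModuleCat.of R (κ → C)))
    {D : ModuleCat.{u} R} (hD : prodClass C D) : leftPerp C D := by
  obtain ⟨I, s, r, hrs⟩ := hD
  intro i hi
  refine extZero_iff.2 fun e => ?_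
  have h1 : ModuleCat.ofHom s ≫ ModuleCat.ofHom r = 𝟙 D := by
    rw [← ModuleCat.ofHom_comp, hrs]; rfl
  have h2 : (Abelian.Ext.mk₀ (ModuleCat.ofHom r)).comp e (zero_add i) = 0 :=
    extZero_iff.1 (hC I i hi) _
  rw [← e.mk₀_id_comp, ← h1, ← Abelian.Ext.mk₀_comp_mk₀_assoc, h2, Abelian.Ext.comp_zero]

/-- The horseshoe lemma for resolutions by modules in `Prod C`. -/
theorem prodRes_extension (hC : ∀ κ : Type u, leftPerp C (ModuleCat.of R (κ → C))) {m : ℕ}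
    {A P B : ModuleCat.{u} R} {f : A →ₗ[R] P} {g : P →ₗ[R] B} (hfg : IsShortExact f g)
    (hA : prodRes C m A) (hB : prodRes C m B) : prodRes C m P := by
  induction m generalizing A P B with
  | zero =>
    have : Subsingleton A := hA
    have : Subsingleton B := hB
    refine subsingleton_of_forall_eq 0 fun x => ?_
    obtain ⟨a, rfl⟩ := (hfg.exact x).1 (Subsingleton.elim _ _)
    rw [Subsingleton.elim a 0, map_zero]
  | succ m ih =>
    have hA' := hA
    obtain ⟨DA, KA, fA, gA, hsA, hDA, hKA⟩ := hA
    obtain ⟨DB, KB, fB, gB, hsB, hDB, hKB⟩ := hB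
    -- DB → B lifts to P because Ext¹(DB, A) = 0, which follows from DB ∈ ⊥C and the resolution of
    -- A.
    obtain ⟨σ, hσ⟩ := hfg.exists_lift
      (extZero_of_prodRes (leftPerp_of_prodClass hC hDB) hA' 0) gB
    let G : (DA × DB) →ₗ[R] P := (f ∘ₗ gA).coprod σ
    have hσ' : ∀ x, g (σ x) = gB x := LinearMap.congr_fun hσ
    have hgf : ∀ x, g (f x) = 0 := hfg.exact.apply_apply_eq_zero
    have hG : Function.Surjective G := by
      intro x
      obtain ⟨b, hb⟩ := hsB.surjective (g x)
      obtain ⟨a, ha⟩ := (hfg.exact (x - σ b)).1 (by rw [map_sub, hσ', hb, sub_self])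
      obtain ⟨a, rfl⟩ := hsA.surjective a
      exact ⟨(a, b), by simp [G, ha]⟩
    refine ⟨ModuleCat.of R (DA × DB), _, _, G, isShortExact_ker (B := ModuleCat.of R (DA × DB)) hG,
      prodClass_prod hDA hDB, ?_⟩
    let eB := LinearEquiv.ofInjective fB hsB.injective
    let β : LinearMap.ker G →ₗ[R] KB := eB.symm.toLinearMap ∘ₗ
      (LinearMap.snd R DA DB ∘ₗ (LinearMap.ker G).subtype).codRestrict (LinearMap.range fB) (by
        rintro ⟨⟨a, b⟩, hx⟩
        have hx' := congrArg g (show f (gA a) + σ b = 0 from hx)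
        rw [map_add, hgf, zero_add, hσ', map_zero] at hx'
        exact (hsB.exact b).1 hx')
    have hβ : ∀ x, fB (β x) = x.1.2 := fun x => congrArg Subtype.val (eB.apply_symm_apply _)
    let α : KA →ₗ[R] LinearMap.ker G := (LinearMap.inl R DA DB ∘ₗ fA).codRestrict _ fun k => by
      simp [G, hsA.exact.apply_apply_eq_zero k]
    -- The kernels form a short exact sequence, to which the induction hypothesis applies.
    have hex : IsShortExact (B := ModuleCat.of R (LinearMap.ker G)) α β := by
      refine ⟨fun x y hxy => hsA.injective (congrArg (fun z => z.1.1) hxy), fun x => ?_,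
        fun k => ?_⟩
      · constructor
        · intro hx
          obtain ⟨⟨a, b⟩, hab⟩ := x
          have hb : b = 0 := by
            have := hβ ⟨⟨a, b⟩, hab⟩
            rw [hx, map_zero] at this
            exact this.symm
          subst hb
          have ha : gA a = 0 := hfg.injective (by simpa [G] using hab)
          obtain ⟨k, rfl⟩ := (hsA.exact a).1 ha
          exact ⟨k, rfl⟩
        · rintro ⟨k, rfl⟩
          exact hsB.injective (by rw [hβ, map_zero]; rfl)
      · obtain ⟨a, ha⟩ := (hfg.exact (σ (fB k))).1 (by
          rw [hσ', hsB.exact.apply_apply_eq_zero])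
        obtain ⟨a, rfl⟩ := hsA.surjective a
        exact ⟨⟨(-a, fB k), by simp [G, ha]⟩, hsB.injective (hβ _)⟩
    exact ih hex hKA hKB

/-- For D → B the first step of a resolution, with kernel K, the kernel of D → M is an extension of
A by K, so the horseshoe lemma resolves it. -/
theorem prodRes_coker (hC : ∀ κ : Type u, leftPerp C (ModuleCat.of R (κ → C))) {m : ℕ}
    {A B M : ModuleCat.{u} R} {f : A →ₗ[R] B} {g : B →ₗ[R] M} (hfg : IsShortExact f g)
    (hA : prodRes C m A) (hB : prodRes C (m + 1) B) : prodRes C (m + 1) M := by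
  obtain ⟨D, K, i, q, hiq, hD, hK⟩ := hB
  refine ⟨D, _, _, g ∘ₗ q, isShortExact_ker (hfg.surjective.comp hiq.surjective), hD, ?_⟩
  let e := LinearEquiv.ofInjective f hfg.injective
  let β : LinearMap.ker (g ∘ₗ q) →ₗ[R] A := e.symm.toLinearMap ∘ₗ
    (q ∘ₗ (LinearMap.ker (g ∘ₗ q)).subtype).codRestrict (LinearMap.range f)
      fun x => (hfg.exact _).1 x.2
  have hβ : ∀ x, f (β x) = q x.1 := fun x => congrArg Subtype.val (e.apply_symm_apply _)
  let α : K →ₗ[R] LinearMap.ker (g ∘ₗ q) := i.codRestrict _ fun k => by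
    simp [hiq.exact.apply_apply_eq_zero k]
  have hex : IsShortExact (B := ModuleCat.of R (LinearMap.ker (g ∘ₗ q))) α β := by
    refine ⟨fun x y hxy => hiq.injective (congrArg Subtype.val hxy), fun x => ?_, fun a => ?_⟩
    · rw [← map_eq_zero_iff f hfg.injective, hβ, hiq.exact]
      exact ⟨fun ⟨k, hk⟩ => ⟨k, Subtype.ext hk⟩, fun ⟨k, hk⟩ => ⟨k, congrArg Subtype.val hk⟩⟩
    · obtain ⟨d, hd⟩ := hiq.surjective (f a)
      have hd' : g (q d) = 0 := by rw [hd, hfg.exact.apply_apply_eq_zero]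
      exact ⟨⟨d, hd'⟩, hfg.injective ((hβ _).trans hd)⟩
  exact prodRes_extension hC hex hK hA

/-- A direct summand `M` of `T` is the cokernel of an endomorphism of `T^ℕ`: the Eilenberg
swindle. -/
theorem exists_isShortExact_of_isSummand {M T : ModuleCat.{u} R} (h : IsSummand M T) :
    ∃ (f : ModuleCat.of R (ULift.{u} ℕ → T) →ₗ[R] ModuleCat.of R (ULift.{u} ℕ → T))
      (g : ModuleCat.of R (ULift.{u} ℕ → T) →ₗ[R] M), IsShortExact f g := by
  obtain ⟨s, r, hrs⟩ := h
  have hrs' : ∀ x, r (s x) = x := LinearMap.congr_fun hrs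
  let π (j : ℕ) : (ULift.{u} ℕ → T) →ₗ[R] T := LinearMap.proj ⟨j⟩
  -- With e = sr, f shifts the eT-parts by one place and fixes the (1 - e)T-parts; only eT ≅ M in
  -- coordinate 0 is missed.
  let f : (ULift.{u} ℕ → T) →ₗ[R] (ULift.{u} ℕ → T) := LinearMap.pi fun i =>
    Nat.casesOn i.down ((LinearMap.id - s ∘ₗ r) ∘ₗ π 0) fun j =>
      (s ∘ₗ r) ∘ₗ π j + (LinearMap.id - s ∘ₗ r) ∘ₗ π (j + 1)
  have hf0 : ∀ t, f t ⟨0⟩ = t ⟨0⟩ - s (r (t ⟨0⟩)) := fun t => rfl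
  have hf1 : ∀ t j, f t ⟨j + 1⟩ = s (r (t ⟨j⟩)) + (t ⟨j + 1⟩ - s (r (t ⟨j + 1⟩))) :=
    fun t j => rfl
  let g : (ULift.{u} ℕ → T) →ₗ[R] M := r ∘ₗ π 0
  refine ⟨f, g, ?_, fun x => ⟨fun hx => ?_, ?_⟩, fun x => ?_⟩
  · rw [← LinearMap.ker_eq_bot, Submodule.eq_bot_iff]
    intro t ht
    have ht' : ∀ i, f t i = 0 := congrFun ht
    have hr : ∀ j, r (t ⟨j⟩) = 0 := fun j => by
      have := congrArg r (ht' ⟨j + 1⟩)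
      rwa [hf1, map_add, map_sub, hrs', hrs', sub_self, add_zero, map_zero] at this
    ext ⟨i⟩
    cases i with
    | zero =>
      have := ht' ⟨0⟩
      rwa [hf0, hr, map_zero, sub_zero] at this
    | succ j =>
      have := ht' ⟨j + 1⟩
      rwa [hf1, hr, hr, map_zero, sub_zero, zero_add] at this
  · have hx' : r (x ⟨0⟩) = 0 := hx
    -- Inverse of f on its image: shift the eT-parts back.
    refine ⟨fun i => s (r (x ⟨i.down + 1⟩)) + (x i - s (r (x i))), ?_⟩
    ext ⟨i⟩
    cases i with
    | zero => simp [hf0, hrs', hx']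
    | succ j => simp [hf1, hrs']
  · rintro ⟨t, rfl⟩
    change r (f t ⟨0⟩) = 0
    rw [hf0, map_sub, hrs', sub_self]
  · exact ⟨fun _ => s x, hrs' x⟩

/-- The swindle presents M by two copies of T^ℕ, so passing to a summand costs one extra step. -/
theorem prodRes_of_isSummand (hC : ∀ κ : Type u, leftPerp C (ModuleCat.of R (κ → C))) {m : ℕ}
    {M T : ModuleCat.{u} R} (h : IsSummand M T) (hT : prodRes C m T) : prodRes C (m + 1) M := by
  obtain ⟨f, g, hfg⟩ := exists_isShortExact_of_isSummand h
  have hpi := prodRes_pi (ι := ULift.{u} ℕ) fun _ => hT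
  exact prodRes_coker hC hfg hpi (prodRes_succ hpi)

theorem exists_resolution_of_prodRes {m : ℕ} {M : ModuleCat.{u} R} (h : prodRes C m M) :
    ∃ (D : ℕ → ModuleCat.{u} R) (ε : D 0 →ₗ[R] M) (d : ∀ i, D (i + 1) →ₗ[R] D i),
      Function.Surjective ε ∧ Function.Exact (d 0) ε ∧ (∀ i, Function.Exact (d (i + 1)) (d i)) ∧
      (∀ i, prodClass C (D i)) ∧ ∀ i, m ≤ i → Subsingleton (D i) := by
  induction m generalizing M with
  | zero =>
    have : Subsingleton M := h
    exact ⟨fun _ => M, 0, fun _ => 0, fun x => ⟨0, Subsingleton.elim _ _⟩,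
      fun x => by simp [Subsingleton.elim x 0], fun i x => by simp [Subsingleton.elim x 0],
      fun _ => prodClass_of_subsingleton, fun _ _ => this⟩
  | succ m ih =>
    obtain ⟨D₀, K, f, g, hfg, hD₀, hK⟩ := h
    obtain ⟨D, ε, d, hε, hdε, hd, hD, hm⟩ := ih hK
    refine ⟨fun i => Nat.casesOn i D₀ D, g, fun i => Nat.casesOn i (f ∘ₗ ε) d, hfg.surjective,
      ?_, ?_, ?_, ?_⟩
    · intro x
      rw [hfg.exact x]
      exact ⟨fun ⟨k, hk⟩ => (hε k).imp fun y hy => by subst hy; exact hk,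
        fun ⟨y, hy⟩ => ⟨ε y, hy⟩⟩
    · rintro (_ | i)
      · intro x
        rw [← hdε x]
        exact map_eq_zero_iff f hfg.injective
      · exact hd i
    · rintro (_ | i)
      · exact hD₀
      · exact hD i
    · rintro (_ | i) hi
      · exact absurd hi (by omega)
      · exact hm i (by omega)

end Resolutions

/-! ### Cogeneration by W and the inclusion ⊥C ⊆ Cog_n C -/

section Cogeneration

variable {R : Type u} [CommRing R]

/-- Rx ≅ R/Ann x maps onto R/P for a maximal P ⊇ Ann x, and this extends from Rx to X by injectivity
of E(R/P). -/
theorem exists_primeHull_map_ne_zero {X : ModuleCat.{u} R} {x : X} (hx : x ≠ 0) :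
    ∃ (p : PrimeSpectrum R) (φ : X →ₗ[R] primeHull p), φ x ≠ 0 := by
  have hne : LinearMap.ker (LinearMap.toSpanSingleton R X x) ≠ ⊤ := by
    intro h
    have h1 : (1 : R) ∈ LinearMap.ker (LinearMap.toSpanSingleton R X x) := h ▸ Submodule.mem_top
    exact hx (by simpa only [LinearMap.mem_ker, LinearMap.toSpanSingleton_apply, one_smul] using h1)
  obtain ⟨P, hP, hle⟩ := Ideal.exists_le_maximal _ hne
  let p : PrimeSpectrum R := ⟨P, hP.isPrime⟩
  have hull := isInjectiveHull_hullMap (ModuleCat.of R (R ⧸ p.asIdeal))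
  let L := LinearMap.ker (LinearMap.toSpanSingleton R X x)
  let j : (R ⧸ L) →ₗ[R] X := L.liftQ (LinearMap.toSpanSingleton R X x) le_rfl
  have hj : Function.Injective j := by
    rw [← LinearMap.ker_eq_bot]
    exact Submodule.ker_liftQ_eq_bot _ _ _ le_rfl
  obtain ⟨φ, hφ⟩ := hull.injective_module.out j hj
    (hullMap (ModuleCat.of R (R ⧸ p.asIdeal)) ∘ₗ Submodule.factor hle)
  refine ⟨p, φ, fun h0 => ?_⟩
  have h1 := hφ (Submodule.Quotient.mk 1)
  have h2 : j (Submodule.Quotient.mk 1) = x := one_smul R x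
  rw [h2] at h1
  have h3 : (Submodule.factor hle (Submodule.Quotient.mk (1 : R)) : R ⧸ P) = 0 :=
    hull.mono ((h1.symm.trans h0).trans (map_zero _).symm)
  have h4 : (Submodule.Quotient.mk (1 : R) : R ⧸ P) = 0 := h3
  rw [Submodule.Quotient.mk_eq_zero] at h4
  exact hP.ne_top ((Ideal.eq_top_iff_one P).2 h4)

/-- The injective cogenerator `∏_𝔭 E(R/𝔭)`. -/
noncomputable def primeHullProd (R : Type u) [CommRing R] : ModuleCat.{u} R :=
  ModuleCat.of R (∀ p : PrimeSpectrum R, primeHull p)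

theorem injective_primeHullProd : Module.Injective R (primeHullProd R) := by
  have : ∀ p : PrimeSpectrum R, Module.Injective R (primeHull p) := injective_primeHull
  exact Module.Injective.pi R fun p : PrimeSpectrum R => primeHull p

theorem exists_primeHullProd_map_ne_zero {X : ModuleCat.{u} R} {x : X} (hx : x ≠ 0) :
    ∃ φ : X →ₗ[R] primeHullProd R, φ x ≠ 0 := by
  classical
  obtain ⟨p, φ, hφ⟩ := exists_primeHull_map_ne_zero hx
  let ψ : X →ₗ[R] primeHullProd R := LinearMap.single R (fun p => primeHull p) p ∘ₗ φ
  refine ⟨ψ, fun h => hφ ?_⟩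
  have h1 : ψ x p = 0 := congrFun h p
  have h2 : ψ x p = φ x := Pi.single_eq_same (M := fun p => primeHull p) p (φ x)
  rw [← h2, h1]

theorem isCoseparator_primeHullProd : IsCoseparator (primeHullProd R) := by
  refine (isCoseparator_def _).2 fun X Z f g hfg => ?_
  ext x
  by_contra hne
  obtain ⟨φ, hφ⟩ := exists_primeHullProd_map_ne_zero (sub_ne_zero.2 hne)
  refine hφ ?_
  rw [map_sub, sub_eq_zero]
  have := congrArg ModuleCat.Hom.hom (hfg (ModuleCat.ofHom φ))
  exact LinearMap.congr_fun this x

variable {C : ModuleCat.{u} R}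

theorem exists_map_ne_zero_of_leftPerp {m : ℕ} (hW : prodRes C m (primeHullProd R))
    {X : ModuleCat.{u} R} (hX : leftPerp C X) {x : X} (hx : x ≠ 0) :
    ∃ φ : X →ₗ[R] C, φ x ≠ 0 := by
  -- Raising the length bound by one ensures that there is a first step D → W, even for m = 0. A
  -- nonzero map to W lifts to D, which sits in a power of C.
  obtain ⟨D, K, f, g, hfg, ⟨I, s, r, hrs⟩, hK⟩ := prodRes_succ hW
  obtain ⟨φ, hφ⟩ := exists_primeHullProd_map_ne_zero hx
  obtain ⟨ψ, rfl⟩ := hfg.exists_lift (extZero_of_prodRes hX hK 0) φ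
  by_contra! h
  have h1 : s (ψ x) = 0 := funext fun i => h (LinearMap.proj i ∘ₗ s ∘ₗ ψ)
  have h2 : r (s (ψ x)) = ψ x := LinearMap.congr_fun hrs (ψ x)
  rw [h1, map_zero] at h2
  exact hφ (by rw [LinearMap.comp_apply, ← h2, map_zero])

/-- The canonical map `X → C^Hom(X, C)`. -/
def evalMap (C X : ModuleCat.{u} R) : X →ₗ[R] ModuleCat.of R ((X →ₗ[R] C) → C) :=
  LinearMap.pi fun φ => φ

/-- The cokernels of the iterated canonical maps `X → C^Hom(X, C)`. -/
def evalCoker (C X : ModuleCat.{u} R) : ℕ → ModuleCat.{u} R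
  | 0 => X
  | i + 1 => ModuleCat.of R
      (((evalCoker C X i →ₗ[R] C) → C) ⧸ LinearMap.range (evalMap C (evalCoker C X i)))

/-- Every φ : X → C extends along the canonical map, by the φ-th projection; this kills Ext¹ of the
cokernel. -/
theorem leftPerp_coker_evalMap (hC : ∀ κ : Type u, leftPerp C (ModuleCat.of R (κ → C)))
    {X : ModuleCat.{u} R} (hX : leftPerp C X) (hinj : Function.Injective (evalMap C X)) :
    leftPerp C (ModuleCat.of R (((X →ₗ[R] C) → C) ⧸ LinearMap.range (evalMap C X))) := by
  have hex := isShortExact_coker hinj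
  rintro (_ | _ | i) hi
  · exact absurd hi (by omega)
  · exact hex.extZero_one_right' (hC _ 1 le_rfl) fun φ => ⟨LinearMap.proj φ, rfl⟩
  · exact hex.extZero_right' (hX _ (Nat.succ_pos i)) (hC _ _ hi)

theorem leftPerp_le_cogClass (hC : ∀ κ : Type u, leftPerp C (ModuleCat.of R (κ → C))) {m : ℕ}
    (hW : prodRes C m (primeHullProd R)) (n : ℕ) : leftPerp C ≤ cogClass n C := by
  intro X hX
  have hinj : ∀ Z, leftPerp C Z → Function.Injective (evalMap C Z) := by
    intro Z hZ
    rw [← LinearMap.ker_eq_bot, Submodule.eq_bot_iff]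
    intro z hz
    by_contra hne
    obtain ⟨φ, hφ⟩ := exists_map_ne_zero_of_leftPerp hW hZ hne
    exact hφ (congrFun hz φ)
  have hperp : ∀ i, leftPerp C (evalCoker C X i) := by
    intro i
    induction i with
    | zero => exact hX
    | succ i ih => exact leftPerp_coker_evalMap hC ih (hinj _ ih)
  have hexact : ∀ i, Function.Exact (evalMap C (evalCoker C X i))
      (evalMap C (evalCoker C X (i + 1)) ∘ₗ
        (LinearMap.range (evalMap C (evalCoker C X i))).mkQ) := by
    intro i x
    rw [← (isShortExact_coker (hinj _ (hperp i))).exact x]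
    exact map_eq_zero_iff _ (hinj _ (hperp (i + 1)))
  refine ⟨fun i => ModuleCat.of R ((evalCoker C X i →ₗ[R] C) → C), evalMap C X,
    fun i => evalMap C (evalCoker C X (i + 1)) ∘ₗ
      (LinearMap.range (evalMap C (evalCoker C X i))).mkQ, hinj X hX, hexact 0, ?_,
    fun i _ => ⟨_, ⟨LinearEquiv.refl R _⟩⟩⟩
  intro i x
  rw [hexact (i + 1) x]
  exact ⟨fun ⟨y, hy⟩ => (Submodule.mkQ_surjective _ y).imp fun z hz => by subst hz; exact hy,
    fun ⟨z, hz⟩ => ⟨_, hz⟩⟩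

theorem prodClass_component {Y : ℕ → Set (PrimeSpectrum R)}
    (D : ∀ p, PrecoverComplex Y p) (p : PrimeSpectrum R) :
    prodClass (cotiltModule D) (D p).component := by
  classical
  refine ⟨PUnit, LinearMap.pi fun _ => LinearMap.single R (fun p => (D p).component) p,
    LinearMap.proj p ∘ₗ LinearMap.proj PUnit.unit, ?_⟩
  ext x
  exact Pi.single_eq_same (M := fun p => (D p).component) p x

end Cogeneration

/-! ### The module C: class inclusions and the cotilting property -/

section Main

variable {R : Type u} [CommRing R] [IsNoetherianRing R] {Y : ℕ → Set (PrimeSpectrum R)}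
  (hmono : Monotone Y) (hgen : ∀ i, IsLowerSet (Y i)) (hR : extClass Y (ModuleCat.of R R))
  (D : ∀ p, PrecoverComplex Y p)

include hmono hgen hR

theorem extClass_cotiltModule : extClass Y (cotiltModule D) :=
  extClass_pi fun p => (D p).extClass_K hmono hgen hR (Nat.zero_le _)

theorem extClass_le_leftPerp : extClass Y ≤ leftPerp (cotiltModule D) := by
  rintro X hX (_ | i) hi
  · exact absurd hi (by omega)
  · exact extZero_pi fun p => (D p).extZero_K hmono hgen hR (Nat.zero_le _) hX i

theorem leftPerp_pow_cotiltModule (κ : Type u) :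
    leftPerp (cotiltModule D) (ModuleCat.of R (κ → cotiltModule D)) :=
  extClass_le_leftPerp hmono hgen hR D _
    (extClass_pi fun _ => extClass_cotiltModule hmono hgen hR D)

theorem cogClass_le_extClass {n : ℕ} (hYn : Y n = Set.univ) :
    cogClass n (cotiltModule D) ≤ extClass Y := by
  rintro M ⟨E, ι, d, hι, hι0, hd, hE⟩ i p hp
  -- Y_i = Spec R for i ≥ n, so there are no conditions beyond the n controlled terms.
  have hin : i < n := by
    by_contra! h
    exact hp (hmono h (hYn ▸ Set.mem_univ p))
  refine extZero_of_exact hmono hp hι hι0 hd fun j hj => ?_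
  obtain ⟨I, ⟨e⟩⟩ := hE j (hj.trans_lt hin)
  intro l q hq
  exact ExtZero.of_isSummand
    (extClass_pi (fun _ : I => extClass_cotiltModule hmono hgen hR D) l q hq)
    (isSummand_of_equiv e)

theorem hasInjectiveDimensionLE_cotiltModule {n : ℕ} (hYn : Y n = Set.univ) :
    HasInjectiveDimensionLE (cotiltModule D) n := by
  refine HasInjectiveDimensionLT.mk fun i hi X => ?_
  obtain ⟨i, rfl⟩ : ∃ l, i = l + 1 := ⟨i - 1, by omega⟩
  refine extZero_iff.1 (extZero_pi fun p =>
    (D p).extZero_K_of_le hmono hgen hR (Nat.zero_le _) X ?_)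
  have : (D p).k ≤ n := (D p).isLeast_k.2 (show p ∈ Y n from hYn ▸ Set.mem_univ p)
  omega

/-- Upward induction: K_0 = C_𝔭 is in Prod C, and K_{i+1} is the cokernel of K_i → E_i. One bound b
serves all primes, as needed for infinite products. -/
theorem prodRes_K {b : ℕ} {p : PrimeSpectrum R}
    (hb : ∀ i < (D p).k, ∀ E, injClass (Y i) E → prodRes (cotiltModule D) b E) {i : ℕ}
    (hi : i ≤ (D p).k) : prodRes (cotiltModule D) (b + i + 1) ((D p).K i) := by
  induction i with
  | zero => exact prodRes_mono (by omega) (prodRes_of_prodClass (prodClass_component D p))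
  | succ i ih =>
    exact prodRes_coker (leftPerp_pow_cotiltModule hmono hgen hR D)
      ((D p).isShortExact hmono hgen hR hi) (ih (by omega))
      (prodRes_mono (by omega) (hb i hi _ ((D p).isPrecover i hi).1))

theorem exists_prodRes_of_injClass (j : ℕ) :
    ∃ m, ∀ i < j, ∀ E, injClass (Y i) E → prodRes (cotiltModule D) m E := by
  induction j with
  | zero => exact ⟨0, fun i hi => absurd hi (Nat.not_lt_zero i)⟩
  | succ j ih =>
    obtain ⟨b, hb⟩ := ih
    -- Here b + j + 1 bounds the resolutions of all E(R/𝔭) with k ≤ j, and the last 1 pays for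
    -- passing to a summand of their product.
    refine ⟨b + j + 1 + 1, fun i hi E hE => ?_⟩
    have hEinj := injective_of_injClass hE
    obtain ⟨ι, p, ⟨e⟩⟩ := exists_primeHull_decomposition hEinj
      ((injClass_iff (hgen i)).1 hE).2
    have hs : IsSummand E (ModuleCat.of R (∀ l, primeHull (p l).1)) := by
      refine isSummand_of_injective hEinj (s := DFinsupp.coeFnLinearMap R ∘ₗ e.toLinearMap) ?_
      exact DFunLike.coe_injective.comp e.injective
    refine prodRes_of_isSummand (leftPerp_pow_cotiltModule hmono hgen hR D) hs
      (prodRes_pi fun l => ?_)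
    have hk : (D (p l).1).k ≤ j := ((D (p l).1).isLeast_k.2 (p l).2).trans (Nat.le_of_lt_succ hi)
    exact prodRes_of_equiv (D (p l).1).top (prodRes_mono (by omega)
      (prodRes_K hmono hgen hR D (fun i hi => hb i (hi.trans_le hk)) le_rfl))

theorem exists_prodRes_primeHullProd {n : ℕ} (hYn : Y n = Set.univ) :
    ∃ m, prodRes (cotiltModule D) m (primeHullProd R) := by
  -- W is in I(Y_n) since Y_n = Spec R, so the bound is needed for all indices below n + 1.
  obtain ⟨m, hm⟩ := exists_prodRes_of_injClass hmono hgen hR D (n + 1)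
  refine ⟨m, hm n (Nat.lt_succ_self n) _ ((injClass_iff (hgen n)).2
    ⟨injective_primeHullProd, fun p hp => ?_⟩)⟩
  exact absurd (hYn ▸ Set.mem_univ p) hp

theorem isNCotilting_cotiltModule {n : ℕ} (hYn : Y n = Set.univ) :
    IsNCotilting n (cotiltModule D) := by
  have hdim := hasInjectiveDimensionLE_cotiltModule hmono hgen hR D hYn
  refine ⟨⟨⟨n, hdim⟩, leftPerp_pow_cotiltModule hmono hgen hR D, ?_⟩, hdim⟩
  obtain ⟨m, hm⟩ := exists_prodRes_primeHullProd hmono hgen hR D hYn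
  obtain ⟨E, ε, d, hε, hdε, hd, hE, hm⟩ := exists_resolution_of_prodRes hm
  exact ⟨primeHullProd R, m, E, ε, d,
    (Module.injective_iff_injective_object R _).1 injective_primeHullProd,
    isCoseparator_primeHullProd, hε, hdε, hd, fun i _ => hE i, fun i hi => hm i hi.le⟩

end Main

end CotiltConstr

theorem theorem4 {R : Type*} [CommRing R] [IsNoetherianRing R]
    (Y : ℕ → Set (PrimeSpectrum R))
    (hmono : Monotone Y)
    (hgen : ∀ i, IsLowerSet (Y i))
    (hass : ∀ (i : ℕ) (p : PrimeSpectrum R),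
      p.asIdeal ∈ associatedPrimes R (CotiltConstr.cosyzygy (ModuleCat.of R R) i) → p ∈ Y i)
    (n : ℕ) (hn : 1 ≤ n) (hYn : Y n = Set.univ) :
    (∃ D : ∀ p, CotiltConstr.PrecoverComplex Y p, ∀ p, (D p).ByCovers) ∧
    ∀ D : ∀ p, CotiltConstr.PrecoverComplex Y p,
      CotiltConstr.leftPerp (CotiltConstr.cotiltModule D) =
        CotiltConstr.cogClass n (CotiltConstr.cotiltModule D) ∧
      CotiltConstr.IsNCotilting n (CotiltConstr.cotiltModule D) ∧
      CotiltConstr.leftPerp (CotiltConstr.cotiltModule D) = CotiltConstr.cotiltClass Y := by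
  have hR : CotiltConstr.extClass Y (ModuleCat.of R R) :=
    (CotiltConstr.extClass_iff_homZero_cosyzygy hmono).2 fun i =>
      CotiltConstr.homZero_of_associatedPrimes (hgen i) (hass i)
  refine ⟨?_, fun D => ?_⟩
  · choose D hD using CotiltConstr.exists_precoverComplex_byCovers hYn
    exact ⟨D, hD⟩
  · obtain ⟨m, hm⟩ := CotiltConstr.exists_prodRes_primeHullProd hmono hgen hR D hYn
    have h₁ := CotiltConstr.extClass_le_leftPerp hmono hgen hR D
    have h₂ := CotiltConstr.leftPerp_le_cogClass
      (CotiltConstr.leftPerp_pow_cotiltModule hmono hgen hR D) hm n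
    have h₃ := CotiltConstr.cogClass_le_extClass hmono hgen hR D hYn
    refine ⟨le_antisymm h₂ (h₃.trans h₁),
      CotiltConstr.isNCotilting_cotiltModule hmono hgen hR D hYn, ?_⟩
    rw [← CotiltConstr.extClass_eq_cotiltClass hmono hgen]
    exact le_antisymm (h₂.trans h₃) h₁
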